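/- Permutations $\sigma$ of $[n]=\{1,\dots,n\}$ ($n\ge 0$) are written as words $\sigma(1)\sigma(2)\cdots\sigma(n)$, and $|\sigma|=n$. The reduction of a word with distinct letters replaces each letter by its rank; $\sigma$ avoids a pattern $\tau$ if no subsequence of $\sigma$ has reduction $\tau$. Let $S_n(\tau)$ be the set of $\tau$-avoiding permutations of $[n]$ and $S(\tau)=\bigcup_n S_n(\tau)$. For a word $w$, $w^{+a}$ is obtained by adding $a$ to every letter, and $w^{a\rtimes b}$ by adding $b$ to every letter that is $\ge a$; $w(a\ldots b)$ denotes the factor $w(a)w(a+1)\cdots w(b)$ (empty if $a>b$), and a dot denotes concatenation. Direct sum: $\alpha\oplus\beta=\alpha\,.\,\beta^{+|\alpha|}$. Direct product: let $T(\beta)=\{i\in[|\beta|] : \beta^{-1}(i)>i<\beta(i)\}$ and $k=1+|T(\beta)|$; then $$\alpha\otimes\beta=\beta^{k\rtimes|\alpha|}(1\ldots k-1)\,.\,\alpha^{+(k-1)}\,.\,\beta^{k\rtimes|\alpha|}(k\ldots|\beta|).$$ Crossings: $\mathrm{crs}(\sigma)$ is the number of pairs $(i,j)$ of indices with $i<j<\sigma(i)<\sigma(j)$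 or $\sigma(i)<\sigma(j)\le i<j$. The Elizalde–Pak map $\Theta=\Phi^{-1}\circ\Psi$ is defined on $S_n(321)$ as follows. Let $(P,Q)$ be the insertion and recording tableaux of $\sigma\in S_n(321)$ under the Robinson–Schensted correspondence (they have at most two rows). The Dyck word $\Psi(\sigma)$ of length $2n$ has as its $i$-th step, for $i=1,\dots,n$, an up-step if $i$ is in the first row of $P$ and a down-step if $i$ is in the second row; its last $n$ steps are given, for $j$ from $n$ down to $1$, by a down-step if $j$ is in the first row of $Q$ and an up-step if $j$ is in the second row. A tunnel of a Dyck path $D$ is a horizontal segment between two lattice points of $D$ that meets $D$ only at these two points and stays below $D$; it goes from the beginning of an up-step to the end of a down-step. Number the up-steps of $D$ from left to right by $n,n-1,\dots,1$ and the down-steps from left to right by $1,2,\dots,n$. Then $\Phi^{-1}(D)(m)=j$ if and only if the tunnel starting with the up-step numbered $m$ ends with the down-step numbered $j$. **Proposition.** 1. $\Theta$ maps $S_n(321)$ into $S_n(132)$ for every $n$. 2. For all $\sigma_1,\sigma_2\in S(321)$ we have $\sigma_1\oplus\sigma_2\in S(321)$ and $$\Theta(\sigma_1\oplus\sigma_2)=\Theta(\sigma_2)\otimes\Theta(\sigma_1).$$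 3. $S(132)$ is closed under $\otimes$: if $\alpha,\beta\in S(132)$ then $\alpha\otimes\beta\in S(132)$. 4. $\otimes$ is associative on $S(132)$: $(\alpha\otimes\beta)\otimes\gamma=\alpha\otimes(\beta\otimes\gamma)$ for all $\alpha,\beta,\gamma\in S(132)$. 5. $\mathrm{crs}(\alpha\otimes\beta)=\mathrm{crs}(\alpha)+\mathrm{crs}(\beta)$ for all $\alpha,\beta\in S(132)$. -/

import Mathlib

namespace PermWord

/-! Permutations are given in one-line notation, as words `σ(1) σ(2) … σ(n)` with letters in `ℕ`.
Positions and values are numbered from `1`. -/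

/-- `w` is (the one-line notation of) a permutation of `[n] = {1, …, n}`. -/
def IsPermOf (n : ℕ) (w : List ℕ) : Prop := w.Perm (List.range' 1 n)

/-- The value `σ(i)`, for `1 ≤ i ≤ |σ|`. -/
def val (w : List ℕ) (i : ℕ) : ℕ := w.getD (i - 1) 0

/-- The value `σ⁻¹(i)`, i.e. the position of the letter `i`, for a letter `i` of `σ`. -/
def invVal (w : List ℕ) (i : ℕ) : ℕ := w.idxOf i + 1

/-- The reduction of a word with distinct letters: each letter is replaced by its rank. -/
def red (w : List ℕ) : List ℕ := w.map fun x => w.countP fun y => decide (y ≤ x)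

/-- `w` has no (not necessarily contiguous) subsequence whose reduction is `τ`. -/
def Avoids (τ w : List ℕ) : Prop := ¬ ∃ s : List ℕ, s.Sublist w ∧ red s = τ

/-- `S_n(τ)`, the set of permutations of `[n]` that avoid `τ`. -/
def avoidersOf (τ : List ℕ) (n : ℕ) : Set (List ℕ) := {w | IsPermOf n w ∧ Avoids τ w}

/-- `S(τ) = ⋃ₙ S_n(τ)`. -/
def avoiders (τ : List ℕ) : Set (List ℕ) := ⋃ n : ℕ, avoidersOf τ n

/-! ### Crossings -/

/-- The pair of indices `(i, j)` is a crossing of `σ`: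
`i < j < σ(i) < σ(j)` or `σ(i) < σ(j) ≤ i < j`. -/
def IsCrossing (w : List ℕ) (i j : ℕ) : Prop :=
  (i < j ∧ j < val w i ∧ val w i < val w j) ∨ (val w i < val w j ∧ val w j ≤ i ∧ i < j)

instance (w : List ℕ) (i j : ℕ) : Decidable (IsCrossing w i j) := by
  unfold IsCrossing; infer_instance

/-- `crs(σ)`, the number of crossings of `σ`. -/
def crs (w : List ℕ) : ℕ :=
  ((Finset.Icc 1 w.length ×ˢ Finset.Icc 1 w.length).filter
    fun p => IsCrossing w p.1 p.2).card

/-! ### Direct sum and direct product -/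

/-- `w^{+a}`: add `a` to every letter. -/
def shift (w : List ℕ) (a : ℕ) : List ℕ := w.map fun x => x + a

/-- `w^{a ⋊ b}`: add `b` to every letter that is at least `a`. -/
def shiftFrom (w : List ℕ) (a b : ℕ) : List ℕ := w.map fun x => if a ≤ x then x + b else x

/-- The direct sum `α ⊕ β = α . β^{+|α|}`. -/
def directSum (α β : List ℕ) : List ℕ := α ++ shift β α.length

/-- `T(σ) = {i ∈ [n] | σ⁻¹(i) > i < σ(i)}`. -/
def T (w : List ℕ) : Finset ℕ :=
  (Finset.Icc 1 w.length).filter fun i => i < invVal w i ∧ i < val w i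

/-- The direct product
`α ⊗ β = β^{k ⋊ |α|}(1 … k-1) . α^{+(k-1)} . β^{k ⋊ |α|}(k … |β|)` with `k = 1 + |T(β)|`,
written here with `t = k - 1 = |T(β)|`. -/
def directProd (α β : List ℕ) : List ℕ :=
  let t := (T β).card
  let β' := shiftFrom β (t + 1) α.length
  β'.take t ++ shift α t ++ β'.drop t

/-! ### The Robinson–Schensted correspondence

A tableau is the list of its rows, from the first row on. -/

/-- Insert `x` in a row: `x` replaces the leftmost letter that is larger than `x`, and this letter
is returned as the bumped one; if there is none, `x` is placed at the end of the row. -/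
def rowInsert (x : ℕ) : List ℕ → List ℕ × Option ℕ
  | [] => ([x], none)
  | y :: r => if x < y then (x :: r, some y) else (y :: (rowInsert x r).1, (rowInsert x r).2)

/-- Insert `x` in a tableau, the bumped letters being inserted in the next row. The second
component is the number (from `0`) of the row in which the new square was created. -/
def tabInsert (x : ℕ) : List (List ℕ) → List (List ℕ) × ℕ
  | [] => ([[x]], 0)
  | r :: rs =>
    match rowInsert x r with
    | (r', none) => (r' :: rs, 0)
    | (r', some y) => (r' :: (tabInsert y rs).1, (tabInsert y rs).2 + 1)

/-- Place `i` at the end of the row number `k` (from `0`) of a tableau. -/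
def placeAt (i : ℕ) : ℕ → List (List ℕ) → List (List ℕ)
  | _, [] => [[i]]
  | 0, r :: rs => (r ++ [i]) :: rs
  | k + 1, r :: rs => r :: placeAt i k rs

/-- One step: insert `(i, x) = (i, σ(i))` in the pair (insertion tableau, recording tableau). -/
def rskStep (PQ : List (List ℕ) × List (List ℕ)) (xi : ℕ × ℕ) :
    List (List ℕ) × List (List ℕ) :=
  ((tabInsert xi.1 PQ.1).1, placeAt xi.2 (tabInsert xi.1 PQ.1).2 PQ.2)

/-- The pair `(P, Q)` of insertion and recording tableaux of a word. -/
def rsk (w : List ℕ) : List (List ℕ) × List (List ℕ) :=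
  (w.zipIdx 1).foldl rskStep ([], [])

/-- The Dyck word `Ψ(σ)`, for `σ ∈ S_n(321)`, with `(P, Q) = RSK(σ)`. In its left half, for `i` from
`1` to `n`, there is an up-step if `i` is in the first row of `P` and a down-step otherwise (`i` is
then in the second row). In its right half, for `j` from `n` down to `1`, there is a down-step if
`j` is in the first row of `Q` and an up-step otherwise. -/
def Psi (w : List ℕ) : List DyckStep :=
  ((List.range' 1 w.length).map fun i =>
      if i ∈ (rsk w).1.headD [] then DyckStep.U else DyckStep.D) ++
    ((List.range' 1 w.length).reverse.map fun j =>
      if j ∈ (rsk w).2.headD [] then DyckStep.D else DyckStep.U)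

/-! ### From Dyck paths to 132-avoiding permutations -/

/-- The ordinate of the lattice point with abscissa `p` of the path `D`. -/
def height (D : List DyckStep) (p : ℕ) : ℤ :=
  ((D.take p).count DyckStep.U : ℤ) - ((D.take p).count DyckStep.D : ℤ)

/-- The horizontal segment between the lattice points of `D` with abscissas `p < q` is a tunnel:
it meets `D` only at its two end points, and stays below `D`. -/
def IsTunnel (D : List DyckStep) (p q : ℕ) : Prop :=
  p < q ∧ q ≤ D.length ∧ height D p = height D q ∧
    ∀ r ∈ Finset.Ioo p q, height D p < height D r

instance (D : List DyckStep) (p q : ℕ) : Decidable (IsTunnel D p q) := by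
  unfold IsTunnel; infer_instance

/-- The abscissa at which the tunnel that starts at the abscissa `p` ends. -/
def tunnelEnd (D : List DyckStep) (p : ℕ) : ℕ :=
  ((List.range (D.length + 1)).find? fun q => decide (IsTunnel D p q)).getD 0

/-- The abscissas at which the up-steps of `D` start, from left to right. -/
def upSteps (D : List DyckStep) : List ℕ :=
  (List.range D.length).filter fun p => decide (D[p]? = some DyckStep.U)

/-- The permutation `Φ⁻¹(D)`. From left to right, the up-steps of `D` are numbered from `n` down to
`1` and the down-steps from `1` up to `n`; then `Φ⁻¹(D)(m) = j` if and only if the tunnel that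
starts with the up-step numbered `m` ends with the down-step numbered `j`. In one-line notation the
up-steps are thus read from right to left, and the number of a down-step is the number of
down-steps up to its end. -/
def PhiInv (D : List DyckStep) : List ℕ :=
  (upSteps D).reverse.map fun p => (D.take (tunnelEnd D p)).count DyckStep.D

/-- The map `Θ = Φ⁻¹ ∘ Ψ` of Elizalde and Pak. -/
def Theta (w : List ℕ) : List ℕ := PhiInv (Psi w)

end PermWord

/-! Draw a permutation as the set of its points (i, σ(i)). If σ avoids 132 and t = |T(σ)|, then T(σ)
= {1, …, t}, the square [t] × [t] contains no point, and the points with both coordinates above t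
form an increasing chain (`T_eq_Icc`, `card_T_lt_val`, `val_le_val_of_card_T_lt`). Conversely, the
last two properties determine t (`T_eq_Icc_of_center`). The product α ⊗ β opens a gap of size |α|
after t, both in the positions and in the values of β, and puts α in the square so obtained.
Avoidance of 132, additivity of |T| (hence associativity) and additivity of crossings follow by
comparing the block α with the points of β; no crossing joins the two.

On the side of paths, two tunnels are nested or disjoint, which is why Φ⁻¹ of a Dyck word avoids
132. If a Dyck word LR is cut at its middle, t is the number of down-steps of L: the up-steps of R
give the first t letters, and the tunnels that pass over the middle, being nested, give the
increasing chain. A Dyck word E inserted at the middle only displaces the other tunnels, so Φ⁻¹(LER)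
= Φ⁻¹(E) ⊗ Φ⁻¹(LR) (`PhiInv_insert`).

In σ₁ ⊕ σ₂ the letters of σ₂ are too large to bump those of σ₁, so Ψ(σ₁ ⊕ σ₂) is Ψ(σ₁) with Ψ(σ₂)
inserted at its middle (`Psi_directSum`). That Ψ(σ) is a Dyck word rests on `exists_bumped`: in a
word avoiding 321, a letter that bumps another one is never bumped itself, so the first row keeps at
least half of the letters. -/

namespace PermWord

/-! ### Patterns of length three and one-line notation -/

theorem red_triple (a b c : ℕ) : red [a, b, c] =
    [([a, b, c].countP fun y => decide (y ≤ a)), ([a, b, c].countP fun y => decide (y ≤ b)),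
      ([a, b, c].countP fun y => decide (y ≤ c))] := rfl

theorem exists_triple_of_red {s : List ℕ} {x y z : ℕ} (h : red s = [x, y, z]) :
    ∃ a b c, s = [a, b, c] := by
  have hl : s.length = 3 := by
    have := congrArg List.length h
    simpa [red] using this
  exact List.length_eq_three.1 hl

theorem red_eq_132_iff (a b c : ℕ) : red [a, b, c] = [1, 3, 2] ↔ a < c ∧ c < b := by
  rw [red_triple]
  simp only [List.countP_cons, List.countP_nil, List.cons.injEq, decide_eq_true_eq, and_true]
  constructor
  · rintro ⟨h1, h2, h3⟩
    split_ifs at h1 h2 h3 <;> omega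
  · rintro ⟨h1, h2⟩
    refine ⟨?_, ?_, ?_⟩ <;> split_ifs <;> omega

theorem red_eq_321_iff (a b c : ℕ) : red [a, b, c] = [3, 2, 1] ↔ c < b ∧ b < a := by
  rw [red_triple]
  simp only [List.countP_cons, List.countP_nil, List.cons.injEq, decide_eq_true_eq, and_true]
  constructor
  · rintro ⟨h1, h2, h3⟩
    split_ifs at h1 h2 h3 <;> omega
  · rintro ⟨h1, h2⟩
    refine ⟨?_, ?_, ?_⟩ <;> split_ifs <;> omega

theorem avoids_132_iff (w : List ℕ) :
    Avoids [1, 3, 2] w ↔ ∀ a b c, [a, b, c].Sublist w → a < c → ¬ c < b := by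
  constructor
  · intro h a b c hs h1 h2
    exact h ⟨_, hs, (red_eq_132_iff a b c).2 ⟨h1, h2⟩⟩
  · rintro h ⟨s, hs, hr⟩
    obtain ⟨a, b, c, rfl⟩ := exists_triple_of_red hr
    obtain ⟨h1, h2⟩ := (red_eq_132_iff a b c).1 hr
    exact h a b c hs h1 h2

theorem avoids_321_iff (w : List ℕ) :
    Avoids [3, 2, 1] w ↔ ∀ a b c, [a, b, c].Sublist w → c < b → ¬ b < a := by
  constructor
  · intro h a b c hs h1 h2
    exact h ⟨_, hs, (red_eq_321_iff a b c).2 ⟨h1, h2⟩⟩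
  · rintro h ⟨s, hs, hr⟩
    obtain ⟨a, b, c, rfl⟩ := exists_triple_of_red hr
    obtain ⟨h1, h2⟩ := (red_eq_321_iff a b c).1 hr
    exact h a b c hs h1 h2

theorem mem_avoiders_iff {τ w : List ℕ} :
    w ∈ avoiders τ ↔ IsPermOf w.length w ∧ Avoids τ w := by
  simp only [avoiders, avoidersOf, Set.mem_iUnion, Set.mem_ofPred_eq]
  constructor
  · rintro ⟨n, hn, h⟩
    have : w.length = n := by simpa using List.Perm.length_eq hn
    exact ⟨this ▸ hn, h⟩
  · rintro ⟨h1, h2⟩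
    exact ⟨_, h1, h2⟩

theorem IsPermOf.length_eq {n : ℕ} {w : List ℕ} (h : IsPermOf n w) : w.length = n := by
  simpa using List.Perm.length_eq h

theorem IsPermOf.nodup {n : ℕ} {w : List ℕ} (h : IsPermOf n w) : w.Nodup :=
  (List.Perm.nodup_iff h).2 (List.nodup_range' (step := 1))

theorem IsPermOf.mem_iff {n : ℕ} {w : List ℕ} (h : IsPermOf n w) {x : ℕ} :
    x ∈ w ↔ 1 ≤ x ∧ x ≤ n := by
  rw [List.Perm.mem_iff h, List.mem_range'_1]
  omega

theorem isPermOf_of_nodup {n : ℕ} {w : List ℕ} (hl : w.length = n) (hd : w.Nodup)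
    (hm : ∀ x ∈ w, 1 ≤ x ∧ x ≤ n) : IsPermOf n w := by
  refine (List.Subperm.perm_of_length_le ?_ ?_)
  · refine List.Nodup.subperm hd fun x hx => ?_
    have := hm x hx
    rw [List.mem_range'_1]; omega
  · simp [hl]

theorem val_eq_getElem {w : List ℕ} {i : ℕ} (h1 : 1 ≤ i) (h2 : i ≤ w.length) :
    val w i = w[i - 1]'(by omega) := by
  simp [val, List.getD_eq_getElem?_getD, List.getElem?_eq_getElem (show i - 1 < w.length by omega)]

theorem IsPermOf.val_mem {n : ℕ} {w : List ℕ} (h : IsPermOf n w) {i : ℕ} (h1 : 1 ≤ i)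
    (h2 : i ≤ n) : 1 ≤ val w i ∧ val w i ≤ n := by
  rw [← h.mem_iff, val_eq_getElem h1 (by rw [h.length_eq]; exact h2)]
  exact List.getElem_mem _

theorem IsPermOf.val_injOn {n : ℕ} {w : List ℕ} (h : IsPermOf n w) {i j : ℕ} (hi : 1 ≤ i)
    (hi' : i ≤ n) (hj : 1 ≤ j) (hj' : j ≤ n) (e : val w i = val w j) : i = j := by
  have hl := h.length_eq
  rw [val_eq_getElem hi (by omega), val_eq_getElem hj (by omega)] at e
  have := (List.Nodup.getElem_inj_iff h.nodup).1 e
  omega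

theorem IsPermOf.invVal_mem {n : ℕ} {w : List ℕ} (h : IsPermOf n w) {v : ℕ} (h1 : 1 ≤ v)
    (h2 : v ≤ n) : 1 ≤ invVal w v ∧ invVal w v ≤ n := by
  have := List.idxOf_lt_length_of_mem (h.mem_iff.2 ⟨h1, h2⟩)
  rw [h.length_eq] at this
  simp only [invVal]
  omega

theorem IsPermOf.val_invVal {n : ℕ} {w : List ℕ} (h : IsPermOf n w) {v : ℕ} (h1 : 1 ≤ v)
    (h2 : v ≤ n) : val w (invVal w v) = v := by
  have hm := h.invVal_mem h1 h2
  rw [val_eq_getElem hm.1 (by rw [h.length_eq]; exact hm.2)]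
  simp [invVal]

theorem IsPermOf.invVal_eq {n : ℕ} {w : List ℕ} (h : IsPermOf n w) {i v : ℕ} (h1 : 1 ≤ i)
    (h2 : i ≤ n) (e : val w i = v) : invVal w v = i := by
  have hv := h.val_mem h1 h2
  rw [e] at hv
  have hm := h.invVal_mem hv.1 hv.2
  exact h.val_injOn hm.1 hm.2 h1 h2 ((h.val_invVal hv.1 hv.2).trans e.symm)

theorem exists_indices_of_triple_sublist {w : List ℕ} {a b c : ℕ} (h : [a, b, c].Sublist w) :
    ∃ i j k, 1 ≤ i ∧ i < j ∧ j < k ∧ k ≤ w.length ∧ val w i = a ∧ val w j = b ∧ val w k = c := by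
  obtain ⟨f, hf⟩ := List.sublist_iff_exists_fin_orderEmbedding_get_eq.1 h
  have e0 := hf ⟨0, by simp⟩
  have e1 := hf ⟨1, by simp⟩
  have e2 := hf ⟨2, by simp⟩
  have l1 : f ⟨0, by simp⟩ < f ⟨1, by simp⟩ := f.lt_iff_lt.2 (by simp)
  have l2 : f ⟨1, by simp⟩ < f ⟨2, by simp⟩ := f.lt_iff_lt.2 (by simp)
  simp only [Fin.lt_def] at l1 l2
  have b0 := (f ⟨0, by simp⟩).2
  have b1 := (f ⟨1, by simp⟩).2
  have b2 := (f ⟨2, by simp⟩).2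
  refine ⟨_, _, _, Nat.le_add_left 1 (f ⟨0, by simp⟩), Nat.add_lt_add_right l1 1,
    Nat.add_lt_add_right l2 1, b2, ?_, ?_, ?_⟩
  · rw [val_eq_getElem (by omega) b0]; simpa using e0.symm
  · rw [val_eq_getElem (by omega) b1]; simpa using e1.symm
  · rw [val_eq_getElem (by omega) b2]; simpa using e2.symm

theorem triple_sublist_of_indices {w : List ℕ} {i j k : ℕ} (hi : 1 ≤ i) (hij : i < j)
    (hjk : j < k) (hk : k ≤ w.length) : [val w i, val w j, val w k].Sublist w := by
  rw [val_eq_getElem hi (by omega), val_eq_getElem (by omega) (by omega),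
    val_eq_getElem (by omega) hk]
  have := List.map_getElem_sublist (l := w)
    (is := [⟨i - 1, by omega⟩, ⟨j - 1, by omega⟩, ⟨k - 1, by omega⟩])
    (by simp; omega)
  simpa using this

theorem avoids_132_iff_val (w : List ℕ) : Avoids [1, 3, 2] w ↔
    ∀ i j k, 1 ≤ i → i < j → j < k → k ≤ w.length → val w i < val w k → ¬ val w k < val w j := by
  rw [avoids_132_iff]
  constructor
  · intro h i j k h1 h2 h3 h4
    exact h _ _ _ (triple_sublist_of_indices h1 h2 h3 h4)
  · intro h a b c hs
    obtain ⟨i, j, k, h1, h2, h3, h4, rfl, rfl, rfl⟩ := exists_indices_of_triple_sublist hs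
    exact h i j k h1 h2 h3 h4

theorem val_append_left {a b : List ℕ} {i : ℕ} (h1 : 1 ≤ i) (h2 : i ≤ a.length) :
    val (a ++ b) i = val a i := by
  simp only [val]
  exact List.getD_append _ _ _ _ (by omega)

theorem val_append_right {a b : List ℕ} {i : ℕ} (h : a.length < i) :
    val (a ++ b) i = val b (i - a.length) := by
  simp only [val]
  rw [List.getD_append_right _ _ _ _ (by omega)]
  congr 1
  omega

theorem val_map {w : List ℕ} (f : ℕ → ℕ) {i : ℕ} (h1 : 1 ≤ i) (h2 : i ≤ w.length) :
    val (w.map f) i = f (val w i) := by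
  rw [val_eq_getElem h1 (by simpa using h2), val_eq_getElem h1 h2]
  simp

theorem val_take {w : List ℕ} {t i : ℕ} (h1 : 1 ≤ i) (h2 : i ≤ t) :
    val (w.take t) i = val w i := by
  simp only [val, List.getD_eq_getElem?_getD]
  rw [List.getElem?_take_of_lt (by omega)]

theorem val_drop {w : List ℕ} {t i : ℕ} (h1 : 1 ≤ i) :
    val (w.drop t) i = val w (t + i) := by
  simp only [val, List.getD_eq_getElem?_getD, List.getElem?_drop]
  congr 2
  omega

/-! ### The set `T` and the center of a 132-avoiding permutation -/

theorem mem_T {w : List ℕ} {i : ℕ} :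
    i ∈ T w ↔ (1 ≤ i ∧ i ≤ w.length) ∧ i < invVal w i ∧ i < val w i := by
  simp [T]

theorem card_T_le (w : List ℕ) : (T w).card ≤ w.length := by
  refine (Finset.card_filter_le _ _).trans ?_
  simp

/-- Each i in S brings the whole of [1, i] with it, so i ≤ |S|; cardinalities then force equality.
-/
theorem eq_Icc_card_of_down_closed {S : Finset ℕ} (h1 : ∀ i ∈ S, 1 ≤ i)
    (h : ∀ i ∈ S, ∀ j, 1 ≤ j → j < i → j ∈ S) : S = Finset.Icc 1 S.card := by
  refine Finset.eq_of_subset_of_card_le (fun i hi => ?_) (by simp)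
  have hs : Finset.Icc 1 i ⊆ S := fun j hj => by
    rw [Finset.mem_Icc] at hj
    rcases hj.2.eq_or_lt with rfl | hlt
    · exact hi
    · exact h i hi j hj.1 hlt
  have := Finset.card_le_card hs
  rw [Nat.card_Icc] at this
  exact Finset.mem_Icc.2 ⟨h1 i hi, by omega⟩

section Center

variable {n : ℕ} {w : List ℕ}

theorem T_eq_Icc (hp : IsPermOf n w) (ha : Avoids [1, 3, 2] w) :
    T w = Finset.Icc 1 (T w).card := by
  rw [avoids_132_iff_val] at ha
  have hl := hp.length_eq
  refine eq_Icc_card_of_down_closed (fun i hi => (mem_T.1 hi).1.1) fun i hi j hj hji => ?_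
  obtain ⟨⟨h1, h2⟩, h3, h4⟩ := mem_T.1 hi
  have hm := hp.invVal_mem h1 (by omega)
  have hv := hp.val_invVal h1 (by omega)
  have hmj := hp.invVal_mem hj (by omega)
  have hvj := hp.val_invVal hj (by omega)
  -- The letters w(i) > i, at position i, and i, further right, serve as 3 and 2. If j failed either
  -- condition, the letter j or the letter w(j) would be a 1 to their left.
  refine mem_T.2 ⟨⟨hj, by omega⟩, ?_, ?_⟩
  · by_contra hc
    exact ha (invVal w j) i (invVal w i) hmj.1 (by omega) h3 (by omega) (by omega) (by omega)
  · by_contra hc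
    exact ha j i (invVal w i) hj hji h3 (by omega) (by omega) (by omega)

theorem mem_T_iff_le_card (hp : IsPermOf n w) (ha : Avoids [1, 3, 2] w) {i : ℕ} :
    i ∈ T w ↔ 1 ≤ i ∧ i ≤ (T w).card := by
  conv_lhs => rw [T_eq_Icc hp ha]
  exact Finset.mem_Icc

/-- Since t = |T(w)| is itself in T(w), the letters w(t) > t and t, the latter to the right of
position t, are a 3 and a 2; a letter below t at a position before t would complete the pattern. -/
theorem card_T_lt_val (hp : IsPermOf n w) (ha : Avoids [1, 3, 2] w) {i : ℕ} (h1 : 1 ≤ i)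
    (h2 : i ≤ (T w).card) : (T w).card < val w i := by
  have hl := hp.length_eq
  have hT := fun i => mem_T_iff_le_card hp ha (i := i)
  rw [avoids_132_iff_val] at ha
  generalize (T w).card = t at *
  obtain ⟨⟨h3, h4⟩, h5, h6⟩ := mem_T.1 ((hT t).2 ⟨by omega, le_rfl⟩)
  by_contra hc
  have hv := hp.val_mem h1 (by omega)
  have hm := hp.invVal_mem h3 (by omega)
  have hmv := hp.val_invVal h3 (by omega)
  have hit : i ≠ t := by rintro rfl; omega
  have hne : val w i ≠ t := by
    intro e
    have := hp.invVal_eq h1 (by omega) e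
    omega
  exact ha i t (invVal w t) h1 (by omega) h5 (by omega) (by omega) (by omega)

/-- Here t + 1 is not in T(w), so either the letter at position t + 1 is at most t + 1, or the
letter t + 1 stands at position t + 1 or before. That letter is the 1 of a 132 whose 3 and 2 would
be a descent in the center. -/
theorem val_le_val_of_card_T_lt (hp : IsPermOf n w) (ha : Avoids [1, 3, 2] w) {i j : ℕ}
    (h1 : (T w).card < i) (hij : i < j) (hj : j ≤ n) (hvj : (T w).card < val w j) :
    val w i ≤ val w j := by
  have hl := hp.length_eq
  have hT := mem_T_iff_le_card hp ha (i := (T w).card + 1)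
  rw [avoids_132_iff_val] at ha
  generalize (T w).card = t at *
  by_contra hc
  have hn : t + 1 ∉ T w := fun h => by have := hT.1 h; omega
  rw [mem_T] at hn
  have hm := hp.invVal_mem (v := t + 1) (by omega) (by omega)
  have hmv := hp.val_invVal (v := t + 1) (by omega) (by omega)
  have hv1 : val w i ≠ t + 1 := by omega
  have hpos : invVal w (t + 1) ≠ i := by intro e; rw [e] at hmv; omega
  by_cases hcase : val w (t + 1) ≤ t + 1
  · have hne : t + 1 ≠ i := by rintro rfl; omega
    refine ha (t + 1) i j (by omega) (by omega) hij (by omega) ?_ (by omega)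
    have hne' : t + 1 ≠ j := by omega
    by_contra hd
    have : val w (t + 1) = val w j := by omega
    exact hne' (hp.val_injOn (by omega) (by omega) (by omega) (by omega) this)
  · have hle : invVal w (t + 1) ≤ t + 1 := by omega
    have hne : invVal w (t + 1) ≠ j := by omega
    refine ha (invVal w (t + 1)) i j (by omega) (by omega) hij (by omega) ?_ (by omega)
    by_contra hd
    have : val w (invVal w (t + 1)) = val w j := by omega
    exact hne (hp.val_injOn (by omega) (by omega) (by omega) (by omega) this)

/-- `t` is the cardinality of `T w` as soon as the first `t` letters exceed `t` and the other
letters that exceed `t` form an increasing word. -/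
theorem T_eq_Icc_of_center (hp : IsPermOf n w) {t : ℕ} (ht : t ≤ n)
    (h1 : ∀ i, 1 ≤ i → i ≤ t → t < val w i)
    (h2 : ∀ i j, t < i → i < j → j ≤ n → t < val w j → val w i ≤ val w j) :
    T w = Finset.Icc 1 t := by
  have hl := hp.length_eq
  ext i
  rw [mem_T, Finset.mem_Icc]
  constructor
  · rintro ⟨⟨h3, h4⟩, h5, h6⟩
    refine ⟨h3, ?_⟩
    by_contra hc
    have hm := hp.invVal_mem h3 (by omega)
    have hv := hp.val_invVal h3 (by omega)
    have := h2 i (invVal w i) (by omega) h5 hm.2 (by omega)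
    omega
  · rintro ⟨h3, h4⟩
    have hm := hp.invVal_mem h3 (by omega)
    have hv := hp.val_invVal h3 (by omega)
    refine ⟨⟨h3, by omega⟩, ?_, by have := h1 i h3 h4; omega⟩
    by_contra hc
    have := h1 (invVal w i) hm.1 (by omega)
    omega

end Center

/-! ### The direct product as the insertion of a block -/

/-- `x ↦ x + m` on the integers greater than `t`, and the identity on the others. -/
def jump (t m x : ℕ) : ℕ := if t + 1 ≤ x then x + m else x

theorem jump_of_le {t m x : ℕ} (h : x ≤ t) : jump t m x = x := if_neg (by omega)

theorem jump_of_lt {t m x : ℕ} (h : t < x) : jump t m x = x + m := if_pos (by omega)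

theorem jump_lt_jump_iff {t m x y : ℕ} : jump t m x < jump t m y ↔ x < y := by
  simp only [jump]; split_ifs <;> omega

theorem jump_le_jump_iff {t m x y : ℕ} : jump t m x ≤ jump t m y ↔ x ≤ y := by
  simp only [jump]; split_ifs <;> omega

theorem directProd_eq (α β : List ℕ) : directProd α β =
    (β.map (jump (T β).card α.length)).take (T β).card ++ shift α (T β).card ++
      (β.map (jump (T β).card α.length)).drop (T β).card := rfl

theorem length_directProd (α β : List ℕ) :
    (directProd α β).length = α.length + β.length := by
  have := card_T_le β
  simp only [directProd_eq, shift, List.length_append, List.length_take, List.length_drop,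
    List.length_map]
  omega

theorem val_directProd_inner (α β : List ℕ) {i : ℕ} (h1 : 1 ≤ i) (h2 : i ≤ α.length) :
    val (directProd α β) (i + (T β).card) = val α i + (T β).card := by
  have hc := card_T_le β
  have hl : ((β.map (jump (T β).card α.length)).take (T β).card).length = (T β).card := by
    simpa using hc
  rw [directProd_eq, List.append_assoc, val_append_right (by omega), hl,
    val_append_left (by omega) (by simp [shift]; omega), shift,
    show i + (T β).card - (T β).card = i by omega, val_map _ h1 h2]

/-- The same strictly increasing `jump` acts on positions and on values, so every comparison among
positions and values of β survives in the product. -/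
theorem val_directProd_outer (α β : List ℕ) {i : ℕ} (h1 : 1 ≤ i) (h2 : i ≤ β.length) :
    val (directProd α β) (jump (T β).card α.length i) = jump (T β).card α.length (val β i) := by
  have hc := card_T_le β
  have hl : ((β.map (jump (T β).card α.length)).take (T β).card).length = (T β).card := by
    simpa using hc
  rw [directProd_eq, List.append_assoc]
  by_cases h : i ≤ (T β).card
  · rw [jump_of_le h, val_append_left h1 (by omega), val_take h1 h, val_map _ h1 h2]
  · rw [jump_of_lt (by omega), val_append_right (by omega), hl,
      val_append_right (by simp [shift]; omega), val_drop (by simp [shift]; omega),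
      val_map _ (by simp [shift]; omega) (by simp [shift]; omega)]
    congr 2
    simp [shift]; omega

/-- The positions of `α ⊗ β` come from positions of `α` or of `β`. -/
theorem directProd_index_cases (t m n : ℕ) {i : ℕ} (ht : t ≤ n) (h1 : 1 ≤ i) (h2 : i ≤ m + n) :
    (∃ j, 1 ≤ j ∧ j ≤ m ∧ i = j + t) ∨ (∃ j, 1 ≤ j ∧ j ≤ n ∧ i = jump t m j) := by
  by_cases ha : i ≤ t
  · exact .inr ⟨i, h1, by omega, (jump_of_le ha).symm⟩
  · by_cases hb : i ≤ t + m
    · exact .inl ⟨i - t, by omega, by omega, by omega⟩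
    · exact .inr ⟨i - m, by omega, by omega, by rw [jump_of_lt (by omega)]; omega⟩

theorem isPermOf_directProd {m n : ℕ} {α β : List ℕ} (hα : IsPermOf m α) (hβ : IsPermOf n β) :
    IsPermOf (m + n) (directProd α β) := by
  have hc := card_T_le β
  rw [hβ.length_eq] at hc
  -- Up to order, the block can be moved to the front, which glues the two parts of β together
  -- again.
  have hp : (directProd α β).Perm (shift α (T β).card ++ β.map (jump (T β).card α.length)) := by
    rw [directProd_eq]
    refine (List.Perm.append_right _ List.perm_append_comm).trans ?_
    rw [List.append_assoc, List.take_append_drop]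
  refine isPermOf_of_nodup ?_ (hp.nodup_iff.2 ?_) fun x hx => ?_
  · rw [length_directProd, hα.length_eq, hβ.length_eq]
  · rw [List.nodup_append, shift]
    refine ⟨hα.nodup.map fun x y h => by simpa using h, hβ.nodup.map ?_, ?_⟩
    · intro x y h
      have h1 := jump_le_jump_iff.1 h.le
      have h2 := jump_le_jump_iff.1 h.ge
      omega
    · intro x hx y hy
      obtain ⟨a, ha, rfl⟩ := List.mem_map.1 hx
      obtain ⟨b, hb, rfl⟩ := List.mem_map.1 hy
      have := hα.mem_iff.1 ha
      have := hα.length_eq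
      simp only [jump]
      split_ifs <;> omega
  · rw [hp.mem_iff, List.mem_append, shift, List.mem_map, List.mem_map] at hx
    have := hα.length_eq
    rcases hx with ⟨a, ha, rfl⟩ | ⟨b, hb, rfl⟩
    · have := hα.mem_iff.1 ha
      omega
    · have := hβ.mem_iff.1 hb
      simp only [jump]
      split_ifs <;> omega

section Product

variable {m n : ℕ} {α β : List ℕ}

theorem avoids_132_directProd (hα : IsPermOf m α) (hβ : IsPermOf n β)
    (aα : Avoids [1, 3, 2] α) (aβ : Avoids [1, 3, 2] β) :
    Avoids [1, 3, 2] (directProd α β) := by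
  have hc := card_T_le β
  have inner := fun {i} => val_directProd_inner α β (i := i)
  have outer := fun {i} => val_directProd_outer α β (i := i)
  have big := fun {i} => card_T_lt_val hβ aβ (i := i)
  have incr := fun {i j} => val_le_val_of_card_T_lt hβ aβ (i := i) (j := j)
  have lα := hα.length_eq
  have lβ := hβ.length_eq
  have vα := fun {i} => hα.val_mem (i := i)
  rw [avoids_132_iff_val] at aα aβ ⊢
  rw [length_directProd, lα, lβ]
  rw [lα] at inner outer aα
  rw [lβ] at outer aβ hc
  generalize (T β).card = t at *
  intro i j k h1 hij hjk hk
  rcases directProd_index_cases t m n hc h1 (by omega) with ⟨i, i1, i2, rfl⟩ | ⟨i, i1, i2, rfl⟩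
  · have := vα i1 i2
    rw [inner i1 i2]
    rcases directProd_index_cases t m n hc (i := k) (by omega) hk with
      ⟨k, k1, k2, rfl⟩ | ⟨k, k1, k2, rfl⟩
    -- A position between two positions of the block lies in the block.
    · have e : j = (j - t) + t := by omega
      rw [inner k1 k2, e, inner (by omega) (by omega)]
      have := aα i (j - t) k i1 (by omega) (by omega) k2
      omega
    · rw [outer k1 k2]
      rcases directProd_index_cases t m n hc (i := j) (by omega) (by omega) with
        ⟨j, j1, j2, rfl⟩ | ⟨j, j1, j2, rfl⟩
      · have := vα j1 j2
        rw [inner j1 j2]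
        simp only [jump] at *
        split_ifs <;> omega
      · rw [outer j1 j2, jump_lt_jump_iff]
        intro hlt
        -- Both j and k stand to the right of the block and k has a letter above it, so they fall
        -- under the increasing part of β.
        have hjt : t < j := by
          by_contra hc
          rw [jump_of_le (by omega)] at hij
          omega
        have hvk : t < val β k := by
          by_contra hc
          rw [jump_of_le (by omega)] at hlt
          omega
        have := incr hjt (jump_lt_jump_iff.1 hjk) k2 hvk
        omega
  · rw [outer i1 i2]
    -- A point of β to the left of the block is above it, so the larger letters are all in β; a
    -- point to the right of the block is followed by points of β only.
    by_cases hit : i ≤ t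
    · have hb := big i1 hit
      have key : ∀ j, 1 ≤ j → j ≤ m + n → t + m < val (directProd α β) j →
          ∃ j', 1 ≤ j' ∧ j' ≤ n ∧ j = jump t m j' := by
        intro j h1 h2 h3
        rcases directProd_index_cases t m n hc h1 h2 with ⟨j, j1, j2, rfl⟩ | h
        · rw [inner j1 j2] at h3
          have := vα j1 j2
          omega
        · exact h
      intro hlt hlt2
      rw [jump_of_lt hb] at hlt
      obtain ⟨j, j1, j2, rfl⟩ := key j (by omega) (by omega) (by omega)
      obtain ⟨k, k1, k2, rfl⟩ := key k (by omega) (by omega) (by omega)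
      rw [outer j1 j2, outer k1 k2, jump_lt_jump_iff] at hlt2
      rw [outer k1 k2, ← jump_of_lt (m := m) hb, jump_lt_jump_iff] at hlt
      exact aβ i j k i1 (jump_lt_jump_iff.1 hij) (jump_lt_jump_iff.1 hjk) k2 hlt hlt2
    · have key : ∀ j, t + m < j → j ≤ m + n → ∃ j', 1 ≤ j' ∧ j' ≤ n ∧ j = jump t m j' := by
        intro j h1 h2
        rcases directProd_index_cases t m n hc (by omega) h2 with ⟨j, j1, j2, rfl⟩ | h
        · omega
        · exact h
      have hi := hij
      rw [jump_of_lt (by omega)] at hi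
      obtain ⟨j, j1, j2, rfl⟩ := key j (by omega) (by omega)
      obtain ⟨k, k1, k2, rfl⟩ := key k (by omega) (by omega)
      rw [outer j1 j2, outer k1 k2, jump_lt_jump_iff, jump_lt_jump_iff]
      exact aβ i j k i1 (jump_lt_jump_iff.1 hij) (jump_lt_jump_iff.1 hjk) k2

theorem directProd_mem_avoiders (hα : α ∈ avoiders [1, 3, 2]) (hβ : β ∈ avoiders [1, 3, 2]) :
    directProd α β ∈ avoiders [1, 3, 2] := by
  rw [mem_avoiders_iff] at *
  exact ⟨by rw [length_directProd]; exact isPermOf_directProd hα.1 hβ.1,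
    avoids_132_directProd hα.1 hβ.1 hα.2 hβ.2⟩

/-- The first t + s letters of the product, where s = |T(α)|, come from the first t of β and the
first s of α. Beyond t + s, the increasing part of α fits below and to the left of that of β, so
`T_eq_Icc_of_center` applies. -/
theorem card_T_directProd (hα : IsPermOf m α) (hβ : IsPermOf n β)
    (aα : Avoids [1, 3, 2] α) (aβ : Avoids [1, 3, 2] β) :
    (T (directProd α β)).card = (T β).card + (T α).card := by
  have hc := card_T_le β
  have hs := card_T_le α
  have inner := fun {i} => val_directProd_inner α β (i := i)
  have outer := fun {i} => val_directProd_outer α β (i := i)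
  have big := fun {i} => card_T_lt_val hβ aβ (i := i)
  have incr := fun {i j} => val_le_val_of_card_T_lt hβ aβ (i := i) (j := j)
  have big' := fun {i} => card_T_lt_val hα aα (i := i)
  have incr' := fun {i j} => val_le_val_of_card_T_lt hα aα (i := i) (j := j)
  have lα := hα.length_eq
  have lβ := hβ.length_eq
  have vα := fun {i} => hα.val_mem (i := i)
  have hp := isPermOf_directProd hα hβ
  rw [lα] at inner outer hs
  rw [lβ] at outer hc
  generalize (T β).card = t at *
  generalize (T α).card = s at *
  rw [T_eq_Icc_of_center (t := t + s) hp (by omega), Nat.card_Icc]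
  · omega
  · intro i h1 h2
    rcases directProd_index_cases t m n hc h1 (by omega) with ⟨i, i1, i2, rfl⟩ | ⟨i, i1, i2, rfl⟩
    · rw [inner i1 i2]
      have := big' i1 (by omega)
      omega
    · rw [outer i1 i2]
      have hit : i ≤ t := by
        by_contra hc
        rw [jump_of_lt (by omega)] at h2
        omega
      have := big i1 hit
      rw [jump_of_lt this]
      omega
  · intro i j h1 hij hj
    rcases directProd_index_cases t m n hc (i := i) (by omega) (by omega) with
      ⟨i, i1, i2, rfl⟩ | ⟨i, i1, i2, rfl⟩
    · have := vα i1 i2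
      rw [inner i1 i2]
      rcases directProd_index_cases t m n hc (i := j) (by omega) (by omega) with
        ⟨j, j1, j2, rfl⟩ | ⟨j, j1, j2, rfl⟩
      · rw [inner j1 j2]
        have := incr' (i := i) (j := j) (by omega) (by omega) j2
        omega
      · rw [outer j1 j2]
        simp only [jump]
        split_ifs <;> omega
    · have hit : t < i := by
        by_contra hc
        rw [jump_of_le (by omega)] at h1
        omega
      have hij' := hij
      rw [jump_of_lt hit] at hij'
      rcases directProd_index_cases t m n hc (i := j) (by omega) (by omega) with
        ⟨j, j1, j2, rfl⟩ | ⟨j, j1, j2, rfl⟩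
      · omega
      · rw [outer i1 i2, outer j1 j2, jump_le_jump_iff]
        intro hlt
        refine incr hit (jump_lt_jump_iff.1 hij) j2 ?_
        by_contra hc
        rw [jump_of_le (by omega)] at hlt
        omega

/-- As |T| is additive, both sides put α after the first |T(γ)| + |T(β)| letters; it remains to
check that the displacements of the letters compose. -/
theorem directProd_assoc {l : ℕ} {γ : List ℕ} (hβ : IsPermOf n β) (hγ : IsPermOf l γ)
    (aβ : Avoids [1, 3, 2] β) (aγ : Avoids [1, 3, 2] γ) :
    directProd (directProd α β) γ = directProd α (directProd β γ) := by
  have hT := card_T_directProd hβ hγ aβ aγ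
  have ht := card_T_le β
  have hu := card_T_le γ
  rw [directProd_eq (directProd α β) γ, directProd_eq α (directProd β γ), hT, length_directProd,
    directProd_eq α β, directProd_eq β γ]
  generalize (T β).card = t at *
  generalize (T γ).card = u at *
  -- The second gap opens at u + t ≤ u + |β|, within the first one or at its end, so the letters of
  -- γ above u jump over both.
  have e1 : (γ.map (jump u β.length)).map (jump (u + t) α.length) =
      γ.map (jump u (α.length + β.length)) := by
    rw [List.map_map]
    refine List.map_congr_left fun x _ => ?_
    simp only [jump, Function.comp]
    split_ifs <;> omega
  have e2 : (shift β u).map (jump (u + t) α.length) = shift (β.map (jump t α.length)) u := by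
    rw [shift, shift, List.map_map, List.map_map]
    refine List.map_congr_left fun x _ => ?_
    simp only [jump, Function.comp]
    split_ifs <;> omega
  have e3 : shift (shift α t) u = shift α (u + t) := by
    rw [shift, shift, shift, List.map_map]
    refine List.map_congr_left fun x _ => ?_
    simp only [Function.comp]
    omega
  have hl : ((γ.map (jump u (α.length + β.length))).take u).length = u := by simpa using hu
  simp only [List.map_append, List.map_take, List.map_drop, e1, e2]
  generalize γ.map (jump u (α.length + β.length)) = γ' at *
  generalize hβ' : β.map (jump t α.length) = β' at *
  have hl' : (β'.take t).length = t := by rw [← hβ']; simpa using ht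
  have hs : ∀ a b : List ℕ, shift (a ++ b) u = shift a u ++ shift b u := fun a b => by
    simp [shift]
  have ht' : t ≤ (shift β' u).length := by rw [← hβ']; simpa [shift] using ht
  have htake : (γ'.take u ++ shift β' u ++ γ'.drop u).take (u + t) =
      γ'.take u ++ shift (β'.take t) u := by
    rw [List.append_assoc, List.take_append, hl, List.take_of_length_le (by omega),
      show u + t - u = t by omega, List.take_append_of_le_length ht']
    simp [shift]
  have hdrop : (γ'.take u ++ shift β' u ++ γ'.drop u).drop (u + t) =
      shift (β'.drop t) u ++ γ'.drop u := by
    rw [List.append_assoc, List.drop_append, hl, List.drop_of_length_le (by omega),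
      show u + t - u = t by omega, List.drop_append_of_le_length ht']
    simp [shift]
  rw [htake, hdrop, hs, hs, e3]
  simp only [List.append_assoc]

/-! ### Crossings of a direct product -/

/-- The finite set of crossings of `w`. -/
def crossings (w : List ℕ) : Finset (ℕ × ℕ) :=
  (Finset.Icc 1 w.length ×ˢ Finset.Icc 1 w.length).filter fun p => IsCrossing w p.1 p.2

theorem crs_eq (w : List ℕ) : crs w = (crossings w).card := rfl

theorem mem_crossings {w : List ℕ} {p : ℕ × ℕ} : p ∈ crossings w ↔
    ((1 ≤ p.1 ∧ p.1 ≤ w.length) ∧ (1 ≤ p.2 ∧ p.2 ≤ w.length)) ∧ IsCrossing w p.1 p.2 := by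
  simp [crossings]

theorem crs_directProd (hα : IsPermOf m α) (hβ : IsPermOf n β) (aβ : Avoids [1, 3, 2] β) :
    crs (directProd α β) = crs α + crs β := by
  have hc := card_T_le β
  have inner := fun {i} => val_directProd_inner α β (i := i)
  have outer := fun {i} => val_directProd_outer α β (i := i)
  have big := fun {i} => card_T_lt_val hβ aβ (i := i)
  have lα := hα.length_eq
  have lβ := hβ.length_eq
  have vα := fun {i} => hα.val_mem (i := i)
  have hl := length_directProd α β
  rw [lα] at inner outer hl
  rw [lβ] at outer hc hl
  generalize (T β).card = t at *
  have jinj : Function.Injective (jump t m) := fun x y h => by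
    have h1 := jump_le_jump_iff.1 h.le
    have h2 := jump_le_jump_iff.1 h.ge
    omega
  have sinj : Function.Injective (fun x => x + t) := fun x y h => by simpa using h
  rw [crs_eq, crs_eq, crs_eq, ← Finset.card_image_of_injective (crossings α) (sinj.prodMap sinj),
    ← Finset.card_image_of_injective (crossings β) (jinj.prodMap jinj),
    ← Finset.card_union_of_disjoint]
  · congr 1
    ext ⟨i, j⟩
    rw [mem_crossings, Finset.mem_union, Finset.mem_image, Finset.mem_image]
    simp only [mem_crossings, Prod.exists, Prod.map_apply, Prod.mk.injEq, hl, lα, lβ]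
    constructor
    · rintro ⟨⟨⟨hi, hi'⟩, hj, hj'⟩, h⟩
      rcases directProd_index_cases t m n hc hi hi' with ⟨i, i1, i2, rfl⟩ | ⟨i, i1, i2, rfl⟩ <;>
      rcases directProd_index_cases t m n hc hj hj' with ⟨j, j1, j2, rfl⟩ | ⟨j, j1, j2, rfl⟩
      · refine .inl ⟨i, j, ⟨⟨⟨i1, i2⟩, j1, j2⟩, ?_⟩, rfl, rfl⟩
        simp only [IsCrossing, inner i1 i2, inner j1 j2] at h ⊢
        omega
      · exfalso
        have := vα i1 i2
        simp only [IsCrossing, inner i1 i2, outer j1 j2] at h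
        simp only [jump] at h
        split_ifs at h <;> omega
      · exfalso
        have := vα j1 j2
        simp only [IsCrossing, inner j1 j2, outer i1 i2] at h
        -- The only mixed case in which the shape of β matters: a point of β to the left of the
        -- block must be above it, so it does not cross a point of the block.
        by_cases hi : i ≤ t
        · have := big i1 hi
          rw [jump_of_le hi, jump_of_lt this] at h
          omega
        · rw [jump_of_lt (by omega)] at h
          omega
      · refine .inr ⟨i, j, ⟨⟨⟨i1, i2⟩, j1, j2⟩, ?_⟩, rfl, rfl⟩
        simpa only [IsCrossing, outer i1 i2, outer j1 j2, jump_lt_jump_iff, jump_le_jump_iff]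
          using h
    · rintro (⟨i, j, ⟨⟨⟨i1, i2⟩, j1, j2⟩, h⟩, rfl, rfl⟩ |
        ⟨i, j, ⟨⟨⟨i1, i2⟩, j1, j2⟩, h⟩, rfl, rfl⟩)
      · refine ⟨by omega, ?_⟩
        simp only [IsCrossing, inner i1 i2, inner j1 j2] at h ⊢
        omega
      · refine ⟨by simp only [jump]; split_ifs <;> omega, ?_⟩
        simpa only [IsCrossing, outer i1 i2, outer j1 j2, jump_lt_jump_iff, jump_le_jump_iff]
          using h
  -- First indices separate the two images: those of the block are in [t + 1, t + m], which `jump t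
  -- m` avoids.
  · rw [Finset.disjoint_left]
    intro p hp hq
    obtain ⟨⟨a, b⟩, h1, rfl⟩ := Finset.mem_image.1 hp
    obtain ⟨⟨c, d⟩, h2, h3⟩ := Finset.mem_image.1 hq
    rw [mem_crossings] at h1
    simp only [Prod.map_apply, Prod.mk.injEq] at h3
    have := h3.1
    simp only [jump] at this
    split_ifs at this <;> omega

end Product

/-! ### Dyck words, tunnels and avoidance of 132 -/

open DyckStep

theorem height_append_left (A B : List DyckStep) {p : ℕ} (h : p ≤ A.length) :
    height (A ++ B) p = height A p := by
  rw [height, height, List.take_append_of_le_length h]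

theorem height_append_right (A B : List DyckStep) (p : ℕ) :
    height (A ++ B) (A.length + p) = height A A.length + height B p := by
  rw [height, height, height, List.take_length_add_append, List.take_length, List.count_append,
    List.count_append]
  push_cast
  ring

theorem height_length_append (A B : List DyckStep) :
    height (A ++ B) A.length = height A A.length := height_append_left A B le_rfl

theorem height_succ_of_up {D : List DyckStep} {p : ℕ} (h : D[p]? = some U) :
    height D (p + 1) = height D p + 1 := by
  simp only [height, List.take_add_one, h, List.count_append]
  simp
  ring

theorem height_succ_of_down {D : List DyckStep} {p : ℕ} (h : D[p]? = some DyckStep.D) :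
    height D (p + 1) = height D p - 1 := by
  simp only [height, List.take_add_one, h, List.count_append]
  simp
  ring

theorem getElem?_eq_up_or_down {D : List DyckStep} {p : ℕ} (h : p < D.length) :
    D[p]? = some U ∨ D[p]? = some DyckStep.D := by
  rw [List.getElem?_eq_getElem h]
  cases D[p] <;> simp

/-- `D` is a Dyck word: its path stays above the horizontal axis, on which it ends. -/
structure IsDyck (D : List DyckStep) : Prop where
  nonneg : ∀ p, 0 ≤ height D p
  height_length : height D D.length = 0

theorem IsDyck.count_down {D : List DyckStep} (h : IsDyck D) : D.count DyckStep.D = D.count U := by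
  have := h.height_length
  rw [height, List.take_length] at this
  omega

/-- The number of down-steps of `D` that end at the abscissa `q` or before. -/
def downs (D : List DyckStep) (q : ℕ) : ℕ := (D.take q).count DyckStep.D

theorem downs_mono (D : List DyckStep) {q r : ℕ} (h : q ≤ r) : downs D q ≤ downs D r :=
  (List.take_sublist_take_left h).count_le _

theorem downs_le (D : List DyckStep) (q : ℕ) : downs D q ≤ D.count DyckStep.D :=
  (List.take_sublist q D).count_le _

theorem downs_lt_downs {D : List DyckStep} {q r : ℕ} (h : q < r)
    (hr : D[r - 1]? = some DyckStep.D) : downs D q < downs D r := by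
  have h1 : downs D r = downs D (r - 1) + 1 := by
    obtain ⟨s, rfl⟩ : ∃ s, r = s + 1 := ⟨r - 1, by omega⟩
    simp only [Nat.add_sub_cancel] at hr ⊢
    simp [downs, List.take_add_one, hr]
  have := downs_mono D (show q ≤ r - 1 by omega)
  omega

theorem PhiInv_eq (D : List DyckStep) :
    PhiInv D = (upSteps D).reverse.map fun p => downs D (tunnelEnd D p) := rfl

theorem mem_upSteps {D : List DyckStep} {p : ℕ} : p ∈ upSteps D ↔ D[p]? = some U := by
  simp only [upSteps, List.mem_filter, List.mem_range, decide_eq_true_eq, and_iff_right_iff_imp]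
  intro h
  exact (List.getElem?_eq_some_iff.1 h).1

theorem upSteps_append (A B : List DyckStep) :
    upSteps (A ++ B) = upSteps A ++ (upSteps B).map (A.length + ·) := by
  rw [upSteps, List.length_append, List.range_add, List.filter_append, List.filter_map]
  congr 1
  · refine List.filter_congr fun p hp => ?_
    rw [List.getElem?_append_left (List.mem_range.1 hp)]
  · rw [upSteps]
    congr 1
    refine List.filter_congr fun p hp => ?_
    simp only [Function.comp]
    rw [List.getElem?_append_right (by omega), Nat.add_sub_cancel_left]

theorem length_upSteps (D : List DyckStep) : (upSteps D).length = D.count U := by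
  induction D using List.reverseRecOn with
  | nil => rfl
  | append_singleton D x ih =>
    rw [upSteps_append, List.length_append, ih, List.length_map, List.count_append]
    cases x <;> rfl

theorem pairwise_upSteps (D : List DyckStep) : (upSteps D).Pairwise (· < ·) :=
  List.Pairwise.filter _ List.pairwise_lt_range

theorem length_PhiInv (D : List DyckStep) : (PhiInv D).length = D.count U := by
  rw [PhiInv_eq, List.length_map, List.length_reverse, length_upSteps]

theorem IsTunnel.unique {D : List DyckStep} {p q r : ℕ} (hq : IsTunnel D p q)
    (hr : IsTunnel D p r) : q = r := by
  obtain ⟨h1, h2, h3, h4⟩ := hq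
  obtain ⟨k1, k2, k3, k4⟩ := hr
  rcases lt_trichotomy q r with h | h | h
  · have := k4 q (Finset.mem_Ioo.2 ⟨h1, h⟩)
    omega
  · exact h
  · have := h4 r (Finset.mem_Ioo.2 ⟨k1, h⟩)
    omega

theorem IsTunnel.tunnelEnd_eq {D : List DyckStep} {p q : ℕ} (h : IsTunnel D p q) :
    tunnelEnd D p = q := by
  rw [tunnelEnd]
  cases hf : (List.range (D.length + 1)).find? fun q => decide (IsTunnel D p q) with
  | none =>
    rw [List.find?_eq_none] at hf
    have := hf q (List.mem_range.2 (by have := h.2.1; omega))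
    simp [h] at this
  | some r =>
    have := List.find?_some hf
    exact (IsTunnel.unique (by simpa using this) h)

/-- The tunnel ends at the first later point that is not above its start. Such a point exists
because the path ends at height 0, and it has exactly the right height because steps have size one.
-/
theorem IsDyck.exists_isTunnel {D : List DyckStep} (hD : IsDyck D) {p : ℕ}
    (hp : D[p]? = some U) : ∃ q, IsTunnel D p q := by
  have hlt := (List.getElem?_eq_some_iff.1 hp).1
  have hex : ∃ q, p < q ∧ height D q ≤ height D p :=
    ⟨D.length, hlt, by rw [hD.height_length]; exact hD.nonneg p⟩
  classical
  obtain ⟨h1, h2⟩ := Nat.find_spec hex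
  have hle : Nat.find hex ≤ D.length :=
    Nat.find_min' hex ⟨hlt, by rw [hD.height_length]; exact hD.nonneg p⟩
  have hmin : ∀ r, p < r → r < Nat.find hex → height D p < height D r := fun r hr hr' => by
    have := Nat.find_min hex hr'
    by_contra hc
    exact this ⟨hr, by omega⟩
  generalize Nat.find hex = q at *
  refine ⟨q, h1, hle, ?_, fun r hr => ?_⟩
  · obtain ⟨s, rfl⟩ : ∃ s, q = s + 1 := ⟨q - 1, by omega⟩
    have hs := height_succ_of_up hp
    rcases (show p ≤ s by omega).eq_or_lt with rfl | hps
    · omega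
    · have := hmin s hps (by omega)
      rcases getElem?_eq_up_or_down (D := D) (p := s) (by omega) with h | h
      · rw [height_succ_of_up h] at h2 ⊢
        omega
      · rw [height_succ_of_down h] at h2 ⊢
        omega
  · rw [Finset.mem_Ioo] at hr
    exact hmin r hr.1 hr.2

theorem IsDyck.isTunnel_tunnelEnd {D : List DyckStep} (hD : IsDyck D) {p : ℕ}
    (hp : p ∈ upSteps D) : IsTunnel D p (tunnelEnd D p) := by
  obtain ⟨q, hq⟩ := hD.exists_isTunnel (mem_upSteps.1 hp)
  rwa [hq.tunnelEnd_eq]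

theorem IsTunnel.last_step {D : List DyckStep} {p q : ℕ} (h : IsTunnel D p q)
    (hp : p ∈ upSteps D) : D[q - 1]? = some DyckStep.D := by
  obtain ⟨h1, h2, h3, h4⟩ := h
  have hs := height_succ_of_up (mem_upSteps.1 hp)
  obtain ⟨s, rfl⟩ : ∃ s, q = s + 1 := ⟨q - 1, by omega⟩
  rw [Nat.add_sub_cancel]
  refine (getElem?_eq_up_or_down (by omega)).resolve_left fun h => ?_
  rw [height_succ_of_up h] at h3
  rcases (show p ≤ s by omega).eq_or_lt with rfl | hps
  · omega
  · have := h4 s (Finset.mem_Ioo.2 ⟨hps, by omega⟩)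
    omega

/-- Two tunnels do not cross. -/
theorem IsTunnel.not_crossing {D : List DyckStep} {p q p' q' : ℕ} (h : IsTunnel D p q)
    (h' : IsTunnel D p' q') (h1 : p < p') (h2 : p' < q) : q' < q := by
  obtain ⟨a1, a2, a3, a4⟩ := h
  obtain ⟨b1, b2, b3, b4⟩ := h'
  have e1 := a4 p' (Finset.mem_Ioo.2 ⟨h1, h2⟩)
  rcases lt_trichotomy q' q with h | h | h
  · exact h
  · subst h; omega
  · have := b4 q (Finset.mem_Ioo.2 ⟨h2, h⟩)
    omega

/-- A tunnel ends with a down-step, so `downs` is strictly increasing on ends of tunnels: letters of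
`PhiInv D` can be compared through abscissas. -/
theorem IsDyck.downs_tunnelEnd_lt_iff {D : List DyckStep} (hD : IsDyck D) {p p' : ℕ}
    (hp' : p' ∈ upSteps D) :
    downs D (tunnelEnd D p) < downs D (tunnelEnd D p') ↔ tunnelEnd D p < tunnelEnd D p' := by
  refine ⟨fun h => ?_, fun h => downs_lt_downs h ((hD.isTunnel_tunnelEnd hp').last_step hp')⟩
  by_contra hc
  have := downs_mono D (not_lt.1 hc)
  omega

theorem IsDyck.isPermOf_PhiInv {D : List DyckStep} (hD : IsDyck D) :
    IsPermOf (D.count U) (PhiInv D) := by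
  refine isPermOf_of_nodup (length_PhiInv D) ?_ fun x hx => ?_
  · rw [PhiInv_eq]
    refine List.Nodup.map_on ?_ (List.nodup_reverse.2 (List.Nodup.filter _ List.nodup_range))
    intro p hp r hr e
    rw [List.mem_reverse] at hp hr
    have h1 := (hD.downs_tunnelEnd_lt_iff (p := p) hr).not.1 (by omega)
    have h2 := (hD.downs_tunnelEnd_lt_iff (p := r) hp).not.1 (by omega)
    have t1 := hD.isTunnel_tunnelEnd hp
    have t2 := hD.isTunnel_tunnelEnd hr
    rcases lt_trichotomy p r with h | h | h
    · have := t1.not_crossing t2 h (by have := t2.1; omega)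
      omega
    · exact h
    · have := t2.not_crossing t1 h (by have := t1.1; omega)
      omega
  · rw [PhiInv_eq] at hx
    obtain ⟨p, hp, rfl⟩ := List.mem_map.1 hx
    rw [List.mem_reverse] at hp
    have ht := hD.isTunnel_tunnelEnd hp
    have := downs_lt_downs (q := 0) (by have := ht.1; omega) (ht.last_step hp)
    have := downs_le D (tunnelEnd D p)
    have := hD.count_down
    omega

theorem IsDyck.avoids_132_PhiInv {D : List DyckStep} (hD : IsDyck D) :
    Avoids [1, 3, 2] (PhiInv D) := by
  rw [avoids_132_iff]
  intro a b c hs h1 h2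
  rw [PhiInv_eq] at hs
  obtain ⟨s, hs, e⟩ := List.sublist_map_iff.1 hs
  obtain ⟨x, y, z, rfl⟩ : ∃ x y z, s = [x, y, z] := List.length_eq_three.1 (by
    simpa using (congrArg List.length e).symm)
  have hpw := List.Pairwise.sublist hs (List.pairwise_reverse.2 (pairwise_upSteps D))
  have hx : x ∈ upSteps D := List.mem_reverse.1 (hs.subset (by simp))
  have hy : y ∈ upSteps D := List.mem_reverse.1 (hs.subset (by simp))
  have hz : z ∈ upSteps D := List.mem_reverse.1 (hs.subset (by simp))
  simp only [List.map_cons, List.map_nil, List.cons.injEq, and_true] at e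
  obtain ⟨rfl, rfl, rfl⟩ := e
  simp only [List.pairwise_cons, List.mem_cons, List.not_mem_nil, or_false, forall_eq_or_imp,
    forall_eq] at hpw
  rw [hD.downs_tunnelEnd_lt_iff hz] at h1
  rw [hD.downs_tunnelEnd_lt_iff hy] at h2
  -- Up-steps are read from right to left, so z < y < x. The tunnel from z ends after the one from
  -- x, hence after y; it then encloses the tunnel from y, whose letter cannot be the 3.
  have := (hD.isTunnel_tunnelEnd hz).not_crossing (hD.isTunnel_tunnelEnd hy) hpw.2.1
    (by have := (hD.isTunnel_tunnelEnd hx).1; omega)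
  omega

theorem IsDyck.PhiInv_mem_avoidersOf {D : List DyckStep} (hD : IsDyck D) :
    PhiInv D ∈ avoidersOf [1, 3, 2] (D.count U) :=
  ⟨hD.isPermOf_PhiInv, hD.avoids_132_PhiInv⟩

/-! ### Inserting a Dyck word into another one -/

section Insertion

variable {L R E : List DyckStep}

theorem height_insert_left {x : ℕ} (h : x ≤ L.length) :
    height (L ++ (E ++ R)) x = height (L ++ R) x := by
  rw [height_append_left _ _ h, height_append_left _ _ h]

theorem height_insert_middle {y : ℕ} (h : y ≤ E.length) :
    height (L ++ (E ++ R)) (L.length + y) = height (L ++ R) L.length + height E y := by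
  rw [height_append_right, height_length_append, height_append_left _ _ h]

theorem height_insert_right (hE : IsDyck E) {x : ℕ} (h : L.length ≤ x) :
    height (L ++ (E ++ R)) (x + E.length) = height (L ++ R) x := by
  obtain ⟨y, rfl⟩ := Nat.exists_eq_add_of_le h
  rw [Nat.add_assoc, height_append_right, Nat.add_comm y, height_append_right, height_append_right,
    hE.height_length, zero_add]

/-- A tunnel over the cut is strictly below the path there, and E never goes below the level at
which it is inserted. A tunnel that ends exactly at the cut does not move, in agreement with `jump`.
-/
theorem IsTunnel.insert_left (hE : IsDyck E) {p q : ℕ} (h : IsTunnel (L ++ R) p q)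
    (hp : p < L.length) : IsTunnel (L ++ (E ++ R)) p (jump L.length E.length q) := by
  obtain ⟨h1, h2, h3, h4⟩ := h
  simp only [List.length_append] at h2
  by_cases hq : q ≤ L.length
  · rw [jump_of_le hq]
    refine ⟨h1, by simp only [List.length_append]; omega, ?_, fun r hr => ?_⟩
    · rw [height_insert_left hp.le, height_insert_left hq, h3]
    · have := Finset.mem_Ioo.1 hr
      rw [height_insert_left hp.le, height_insert_left (by omega)]
      exact h4 r hr
  · rw [jump_of_lt (by omega)]
    refine ⟨by omega, by simp only [List.length_append]; omega, ?_, fun r hr => ?_⟩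
    · rw [height_insert_left hp.le, height_insert_right hE (by omega), h3]
    · rw [Finset.mem_Ioo] at hr
      rw [height_insert_left hp.le]
      by_cases hr1 : r ≤ L.length
      · rw [height_insert_left hr1]
        exact h4 r (Finset.mem_Ioo.2 ⟨hr.1, by omega⟩)
      · by_cases hr2 : r ≤ L.length + E.length
        · obtain ⟨y, rfl⟩ := Nat.exists_eq_add_of_le (not_le.1 hr1).le
          rw [height_insert_middle (by omega)]
          have := h4 L.length (Finset.mem_Ioo.2 ⟨hp, by omega⟩)
          have := hE.nonneg y
          omega
        · rw [show r = (r - E.length) + E.length by omega, height_insert_right hE (by omega)]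
          exact h4 _ (Finset.mem_Ioo.2 ⟨by omega, by omega⟩)

theorem IsTunnel.insert_right (hE : IsDyck E) {p q : ℕ} (h : IsTunnel (L ++ R) p q)
    (hp : L.length ≤ p) : IsTunnel (L ++ (E ++ R)) (p + E.length) (q + E.length) := by
  obtain ⟨h1, h2, h3, h4⟩ := h
  simp only [List.length_append] at h2
  refine ⟨by omega, by simp only [List.length_append]; omega, ?_, fun r hr => ?_⟩
  · rw [height_insert_right hE hp, height_insert_right hE (by omega), h3]
  · rw [Finset.mem_Ioo] at hr
    rw [height_insert_right hE hp, show r = (r - E.length) + E.length by omega,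
      height_insert_right hE (by omega)]
    exact h4 _ (Finset.mem_Ioo.2 ⟨by omega, by omega⟩)

theorem IsTunnel.insert_middle {p q : ℕ} (h : IsTunnel E p q) :
    IsTunnel (L ++ (E ++ R)) (L.length + p) (L.length + q) := by
  obtain ⟨h1, h2, h3, h4⟩ := h
  refine ⟨by omega, by simp only [List.length_append]; omega, ?_, fun r hr => ?_⟩
  · rw [height_insert_middle (by omega), height_insert_middle h2, h3]
  · rw [Finset.mem_Ioo] at hr
    obtain ⟨y, rfl⟩ := Nat.exists_eq_add_of_le (show L.length ≤ r by omega)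
    rw [height_insert_middle (by omega), height_insert_middle (by omega)]
    have := h4 y (Finset.mem_Ioo.2 ⟨by omega, by omega⟩)
    omega

theorem downs_append_left (A B : List DyckStep) {q : ℕ} (h : q ≤ A.length) :
    downs (A ++ B) q = downs A q := by
  rw [downs, downs, List.take_append_of_le_length h]

theorem downs_append_right (A B : List DyckStep) (q : ℕ) :
    downs (A ++ B) (A.length + q) = A.count DyckStep.D + downs B q := by
  rw [downs, downs, List.take_length_add_append, List.count_append]

/-- The end of a tunnel is beyond the cut exactly when the number of its last down-step exceeds the
number of down-steps of L, so abscissa and number jump together. -/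
theorem downs_insert_jump (hE : IsDyck E) {p q : ℕ} (hp : p ∈ upSteps (L ++ R))
    (h : IsTunnel (L ++ R) p q) :
    downs (L ++ (E ++ R)) (jump L.length E.length q) =
      jump (L.count DyckStep.D) (E.count U) (downs (L ++ R) q) := by
  by_cases hq : q ≤ L.length
  · rw [jump_of_le hq, downs_append_left _ _ hq, downs_append_left _ _ hq,
      jump_of_le (downs_le L q)]
  · have hlt := downs_lt_downs (not_le.1 hq) (h.last_step hp)
    rw [downs_append_left _ _ le_rfl, downs, List.take_length] at hlt
    rw [jump_of_lt hlt, jump_of_lt (by omega)]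
    obtain ⟨y, rfl⟩ := Nat.exists_eq_add_of_le (not_le.1 hq).le
    rw [show L.length + y + E.length = L.length + (E.length + y) by omega, downs_append_right,
      downs_append_right, downs_append_right, hE.count_down]
    omega

/-- As up-steps are read from right to left, those of R come first; this is the place where
`directProd` cuts the word. -/
theorem PhiInv_append_eq (L R : List DyckStep) : PhiInv (L ++ R) =
    ((upSteps R).reverse.map fun p => downs (L ++ R) (tunnelEnd (L ++ R) (L.length + p))) ++
      (upSteps L).reverse.map fun p => downs (L ++ R) (tunnelEnd (L ++ R) p) := by
  rw [PhiInv_eq, upSteps_append, List.reverse_append, List.map_append, ← List.map_reverse,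
    List.map_map]
  rfl

/-- Tunnels that start in R end in R, so their letters exceed the number of down-steps of L. Those
from L to R all pass over the cut, hence are nested, and their ends increase when the starts are
read from right to left. -/
theorem card_T_PhiInv (hD : IsDyck (L ++ R)) (h : L.count DyckStep.D = R.count U) :
    (T (PhiInv (L ++ R))).card = L.count DyckStep.D := by
  have hp := hD.isPermOf_PhiInv
  have hlen := hp.length_eq
  have hcount : downs (L ++ R) L.length = L.count DyckStep.D := by
    rw [downs_append_left _ _ le_rfl, downs, List.take_length]
  have hA : ∀ x ∈ (upSteps R).reverse.map
      fun p => downs (L ++ R) (tunnelEnd (L ++ R) (L.length + p)), L.count DyckStep.D < x := by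
    intro x hx
    obtain ⟨p, hp, rfl⟩ := List.mem_map.1 hx
    have hm : L.length + p ∈ upSteps (L ++ R) := by
      rw [upSteps_append, List.mem_append, List.mem_map]
      exact .inr ⟨p, List.mem_reverse.1 hp, rfl⟩
    have ht := hD.isTunnel_tunnelEnd hm
    rw [← hcount]
    exact downs_lt_downs (by have := ht.1; omega) (ht.last_step hm)
  have hB : ((upSteps L).reverse.map fun p => downs (L ++ R) (tunnelEnd (L ++ R) p)).Pairwise
      (fun x y => L.count DyckStep.D < y → x ≤ y) := by
    rw [List.pairwise_map]
    refine List.Pairwise.imp_of_mem ?_ (List.pairwise_reverse.2 (pairwise_upSteps L))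
    intro p r hp hr hlt hd
    rw [List.mem_reverse] at hp hr
    have hpL := (List.getElem?_eq_some_iff.1 (mem_upSteps.1 hp)).1
    have hm : ∀ {p}, p ∈ upSteps L → p ∈ upSteps (L ++ R) := fun h => by
      rw [upSteps_append, List.mem_append]
      exact .inl h
    refine downs_mono _ (((hD.isTunnel_tunnelEnd (hm hr)).not_crossing
      (hD.isTunnel_tunnelEnd (hm hp)) hlt ?_).le)
    -- A letter above the number of down-steps of L belongs to a tunnel that ends beyond the cut,
    -- hence beyond p.
    by_contra hc
    have := downs_mono (L ++ R) (show tunnelEnd (L ++ R) r ≤ L.length by omega)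
    omega
  have hl : ((upSteps R).reverse.map
      fun p => downs (L ++ R) (tunnelEnd (L ++ R) (L.length + p))).length =
      L.count DyckStep.D := by
    rw [List.length_map, List.length_reverse, length_upSteps, h]
  rw [PhiInv_append_eq] at hp hlen ⊢
  generalize (upSteps R).reverse.map
      (fun p => downs (L ++ R) (tunnelEnd (L ++ R) (L.length + p))) = A at *
  generalize (upSteps L).reverse.map (fun p => downs (L ++ R) (tunnelEnd (L ++ R) p)) = B at *
  rw [List.length_append] at hlen
  rw [T_eq_Icc_of_center (t := L.count DyckStep.D) hp (by omega), Nat.card_Icc]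
  · omega
  · intro i h1 h2
    rw [val_append_left h1 (by omega), val_eq_getElem h1 (by omega)]
    exact hA _ (List.getElem_mem _)
  · intro i j h1 hij hj hv
    rw [val_append_right (by omega), val_eq_getElem (by omega) (by omega)] at hv ⊢
    rw [val_append_right (by omega), val_eq_getElem (by omega) (by omega)]
    exact List.pairwise_iff_getElem.1 hB _ _ _ _ (by omega) hv

/-- Inserting a Dyck word `E` at the center of another one amounts to a direct product. -/
theorem PhiInv_insert (hD : IsDyck (L ++ R)) (hE : IsDyck E)
    (h : L.count DyckStep.D = R.count U) :
    PhiInv (L ++ (E ++ R)) = directProd (PhiInv E) (PhiInv (L ++ R)) := by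
  rw [directProd_eq, card_T_PhiInv hD h, length_PhiInv, PhiInv_append_eq L R, List.map_append,
    List.take_left', List.drop_left', PhiInv_eq, upSteps_append, upSteps_append]
  rotate_left
  · rw [List.length_map, List.length_map, List.length_reverse, length_upSteps, h]
  · rw [List.length_map, List.length_map, List.length_reverse, length_upSteps, h]
  simp only [List.reverse_append, List.map_append, ← List.map_reverse, List.map_map, PhiInv_eq E,
    shift]
  -- The three blocks of letters come from the up-steps of R, E and L, in this order.
  congr 1
  · congr 1
    · refine List.map_congr_left fun p hp => ?_
      simp only [Function.comp]
      have hm : L.length + p ∈ upSteps (L ++ R) := by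
        rw [upSteps_append, List.mem_append, List.mem_map]
        exact .inr ⟨p, List.mem_reverse.1 hp, rfl⟩
      have ht := hD.isTunnel_tunnelEnd hm
      rw [← downs_insert_jump hE hm ht, jump_of_lt (by have := ht.1; omega),
        show L.length + (E.length + p) = L.length + p + E.length by omega,
        (ht.insert_right hE (by omega)).tunnelEnd_eq]
    · refine List.map_congr_left fun p hp => ?_
      simp only [Function.comp]
      have ht := hE.isTunnel_tunnelEnd (List.mem_reverse.1 hp)
      rw [ht.insert_middle.tunnelEnd_eq, downs_append_right, downs_append_left _ _ ht.2.1]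
      omega
  · refine List.map_congr_left fun p hp => ?_
    simp only [Function.comp]
    rw [List.mem_reverse] at hp
    have hm : p ∈ upSteps (L ++ R) := by
      rw [upSteps_append, List.mem_append]
      exact .inl hp
    have ht := hD.isTunnel_tunnelEnd hm
    rw [← downs_insert_jump hE hm ht, (ht.insert_left hE
      (List.getElem?_eq_some_iff.1 (mem_upSteps.1 hp)).1).tunnelEnd_eq]

end Insertion

/-! ### Row insertion and the first rows of the tableaux -/

theorem rowInsert_eq_none {x : ℕ} {r : List ℕ} (h : (rowInsert x r).2 = none) :
    (rowInsert x r).1 = r ++ [x] := by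
  induction r with
  | nil => rfl
  | cons y r ih =>
    simp only [rowInsert] at h ⊢
    split_ifs at h ⊢
    rw [ih h, List.cons_append]

theorem rowInsert_eq_some {x y : ℕ} {r : List ℕ} (h : (rowInsert x r).2 = some y) :
    x < y ∧ (y :: (rowInsert x r).1).Perm (x :: r) := by
  induction r with
  | nil => simp [rowInsert] at h
  | cons z r ih =>
    simp only [rowInsert] at h ⊢
    split_ifs at h ⊢ with hz
    · simp only [Option.some.injEq] at h
      subst h
      exact ⟨hz, List.Perm.swap _ _ _⟩
    · obtain ⟨h1, h2⟩ := ih h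
      exact ⟨h1, (List.Perm.swap _ _ _).trans ((h2.cons z).trans (List.Perm.swap _ _ _))⟩

theorem rowInsert_append {x : ℕ} {a : List ℕ} (b : List ℕ) (h : ∀ y ∈ a, y ≤ x) :
    rowInsert x (a ++ b) = (a ++ (rowInsert x b).1, (rowInsert x b).2) := by
  induction a with
  | nil => rfl
  | cons y a ih =>
    have hy := h y (by simp)
    rw [List.cons_append, rowInsert, if_neg (by omega), ih fun z hz => h z (by simp [hz])]
    rfl

theorem rowInsert_shift (x m : ℕ) (r : List ℕ) : rowInsert (x + m) (shift r m) =
    (shift (rowInsert x r).1 m, (rowInsert x r).2.map (· + m)) := by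
  induction r with
  | nil => rfl
  | cons y r ih =>
    have e : shift (y :: r) m = (y + m) :: shift r m := rfl
    rw [e, rowInsert, rowInsert, ih]
    by_cases h : x < y
    · rw [if_pos h, if_pos (by omega)]
      rfl
    · rw [if_neg h, if_neg (by omega)]
      rfl

/-- The first row of the insertion tableau. -/
def insRow (w : List ℕ) : List ℕ := (rsk w).1.headD []

/-- The first row of the recording tableau. -/
def recRow (w : List ℕ) : List ℕ := (rsk w).2.headD []

theorem rsk_append_singleton (w : List ℕ) (x : ℕ) :
    rsk (w ++ [x]) = rskStep (rsk w) (x, w.length + 1) := by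
  rw [rsk, List.zipIdx_append, List.foldl_append, Nat.add_comm]
  rfl

/-- The first row evolves independently of the rows below, which can therefore be ignored
throughout. -/
theorem insRow_append_singleton (w : List ℕ) (x : ℕ) :
    insRow (w ++ [x]) = (rowInsert x (insRow w)).1 := by
  rw [insRow, insRow, rsk_append_singleton, rskStep]
  cases (rsk w).1 with
  | nil => rfl
  | cons r rs =>
    simp only [tabInsert, List.headD_cons]
    split <;> simp_all

/-- In an empty tableau `placeAt` fills the first row whatever the requested row; this excludes that
case after the first letter. -/
theorem rsk_snd_ne_nil {w : List ℕ} (h : w ≠ []) : (rsk w).2 ≠ [] := by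
  obtain ⟨u, x, rfl⟩ := List.eq_nil_or_concat w |>.resolve_left h
  rw [List.concat_eq_append, rsk_append_singleton, rskStep]
  generalize (tabInsert x (rsk u).1).2 = k
  cases (rsk u).2 <;> cases k <;> simp [placeAt]

theorem recRow_append_singleton (w : List ℕ) (x : ℕ) :
    recRow (w ++ [x]) =
      if (rowInsert x (insRow w)).2 = none then recRow w ++ [w.length + 1] else recRow w := by
  rw [insRow, recRow, recRow, rsk_append_singleton, rskStep]
  rcases eq_or_ne w [] with rfl | hw
  · rfl
  · have h2 := rsk_snd_ne_nil hw
    cases hQ : (rsk w).2 with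
    | nil => exact absurd hQ h2
    | cons q qs =>
      cases hP : (rsk w).1 with
      | nil => rfl
      | cons r rs =>
        simp only [tabInsert, List.headD_cons]
        split <;> simp_all [placeAt]

theorem insRow_subset (w : List ℕ) : (insRow w).Subperm w := by
  induction w using List.reverseRecOn with
  | nil => exact List.Perm.subperm (List.Perm.refl _)
  | append_singleton w x ih =>
    rw [insRow_append_singleton]
    cases h : (rowInsert x (insRow w)).2 with
    | none =>
      rw [rowInsert_eq_none h]
      exact (List.subperm_append_right _).2 ih
    | some y =>
      have hp := (rowInsert_eq_some h).2
      have h1 : (rowInsert x (insRow w)).1.Subperm (x :: insRow w) :=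
        (List.sublist_cons_self y _).subperm.trans hp.subperm
      refine h1.trans (((List.subperm_cons x).2 ih).trans (List.Perm.subperm ?_))
      exact (List.perm_append_singleton x w).symm

theorem length_insRow (w : List ℕ) : (insRow w).length = (recRow w).length := by
  induction w using List.reverseRecOn with
  | nil => rfl
  | append_singleton w x ih =>
    rw [insRow_append_singleton, recRow_append_singleton]
    cases h : (rowInsert x (insRow w)).2 with
    | none =>
      rw [rowInsert_eq_none h]
      simp [ih]
    | some y =>
      have := (rowInsert_eq_some h).2.length_eq
      simp only [List.length_cons, Nat.add_right_cancel_iff] at this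
      simp [this, ih]

theorem recRow_sublist (w : List ℕ) : (recRow w).Sublist (List.range' 1 w.length) := by
  induction w using List.reverseRecOn with
  | nil => exact List.Sublist.refl _
  | append_singleton w x ih =>
    rw [recRow_append_singleton, List.length_append, List.length_singleton, List.range'_concat,
      one_mul, Nat.add_comm 1]
    split_ifs
    · exact ih.append_right _
    · exact ih.trans (List.sublist_append_left _ _)

/-- Recording entries are positions and never move, so truncating the word truncates the row. -/
theorem recRow_take (w : List ℕ) {j : ℕ} (hj : j ≤ w.length) :
    recRow (w.take j) = (recRow w).filter fun i => decide (i ≤ j) := by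
  induction w using List.reverseRecOn with
  | nil => simp only [List.take_nil]; rfl
  | append_singleton w x ih =>
    rcases hj.eq_or_lt with rfl | hlt
    · rw [List.take_length, eq_comm, List.filter_eq_self]
      intro i hi
      have := (recRow_sublist _).subset hi
      rw [List.mem_range'_1] at this
      simp only [decide_eq_true_eq]
      omega
    · rw [List.length_append, List.length_singleton] at hlt
      rw [List.take_append_of_le_length (by omega), ih (by omega), recRow_append_singleton]
      split_ifs
      · rw [List.filter_append]
        simp
        omega
      · rfl

/-- In a word that avoids `321`, the letters that leave the first row of the insertion tableau
(listed in `b`) are larger than the letters that displace them (listed in `c`), and the latter stay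
in the first row. -/
theorem exists_bumped {w : List ℕ} (ha : Avoids [3, 2, 1] w) :
    ∃ b c : List ℕ, (insRow w ++ b).Perm w ∧ List.Forall₂ (· < ·) c b ∧
      c.Subperm (insRow w) ∧ ∀ x ∈ c, ∃ y, x < y ∧ [y, x].Sublist w := by
  rw [avoids_321_iff] at ha
  induction w using List.reverseRecOn with
  | nil => exact ⟨[], [], List.Perm.refl _, .nil, List.Subperm.refl _, by simp⟩
  | append_singleton w x ih =>
    obtain ⟨b, c, h1, h2, h3, h4⟩ := ih fun p q r h => ha p q r (h.trans (by simp))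
    have h4' : ∀ z ∈ c, ∃ y, z < y ∧ [y, z].Sublist (w ++ [x]) := fun z hz => by
      obtain ⟨y, hy, hs⟩ := h4 z hz
      exact ⟨y, hy, hs.trans (by simp)⟩
    rw [insRow_append_singleton]
    cases h : (rowInsert x (insRow w)).2 with
    | none =>
      rw [rowInsert_eq_none h]
      refine ⟨b, c, ?_, h2, h3.trans (List.sublist_append_left _ _).subperm, h4'⟩
      rw [List.append_assoc]
      refine (List.Perm.append_left _ List.perm_append_comm).trans ?_
      rw [← List.append_assoc]
      exact h1.append_right _
    | some y =>
      obtain ⟨hxy, hp⟩ := rowInsert_eq_some h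
      have hyw : y ∈ w := by
        have : y ∈ x :: insRow w := hp.subset (by simp)
        rcases List.mem_cons.1 this with rfl | hm
        · omega
        · exact (insRow_subset w).subset hm
      -- If y had displaced a letter, some larger z would precede it, and z y x would be a 321.
      have hyc : y ∉ c := fun hc => by
        obtain ⟨z, hz, hs⟩ := h4 y hc
        exact ha z y x (List.Sublist.append hs (List.Sublist.refl [x])) hxy hz
      refine ⟨y :: b, x :: c, ?_, .cons hxy h2, ?_, ?_⟩
      · refine List.perm_middle.trans ?_
        rw [← List.cons_append]
        refine (hp.append_right b).trans ((h1.cons x).trans ?_)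
        exact (List.perm_append_singleton x w).symm
      -- The old row with x added is the new row with y added; y can be erased because it is neither
      -- x nor in c.
      · have hs : (x :: c).Subperm (y :: (rowInsert x (insRow w)).1) :=
          ((List.subperm_cons x).2 h3).trans hp.symm.subperm
        have := hs.erase y
        rwa [List.erase_cons_head, List.erase_of_not_mem (by
          rw [List.mem_cons, not_or]; exact ⟨by omega, hyc⟩)] at this
      · intro z hz
        rcases List.mem_cons.1 hz with rfl | hz
        · exact ⟨y, hxy, List.Sublist.append (List.singleton_sublist.2 hyw) (List.Sublist.refl [z])⟩
        · exact h4' z hz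

theorem countP_le_of_forall₂_lt {c b : List ℕ} (h : List.Forall₂ (· < ·) c b) (v : ℕ) :
    b.countP (fun i => decide (i ≤ v)) ≤ c.countP (fun i => decide (i ≤ v)) := by
  induction h with
  | nil => exact le_rfl
  | cons hlt _ ih =>
    simp only [List.countP_cons, decide_eq_true_eq]
    split_ifs <;> omega

/-- In a word that avoids `321`, at least half of the letters `≤ v` are in the first row of the
insertion tableau. -/
theorem countP_le_two_mul_countP_insRow {w : List ℕ} (ha : Avoids [3, 2, 1] w) (v : ℕ) :
    w.countP (fun i => decide (i ≤ v)) ≤ 2 * (insRow w).countP fun i => decide (i ≤ v) := by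
  obtain ⟨b, c, h1, h2, h3, -⟩ := exists_bumped ha
  have e1 := h1.countP_eq fun i => decide (i ≤ v)
  have e2 := countP_le_of_forall₂_lt h2 v
  have e3 := h3.countP_le fun i => decide (i ≤ v)
  rw [List.countP_append] at e1
  omega

theorem Avoids.of_sublist {τ u w : List ℕ} (h : Avoids τ w) (hs : u.Sublist w) : Avoids τ u :=
  fun ⟨s, h1, h2⟩ => h ⟨s, h1.trans hs, h2⟩

theorem length_le_two_mul_length_insRow {w : List ℕ} (ha : Avoids [3, 2, 1] w) :
    w.length ≤ 2 * (insRow w).length := by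
  obtain ⟨b, c, h1, h2, h3, -⟩ := exists_bumped ha
  have e1 := h1.length_eq
  have e2 := h2.length_eq
  have e3 := h3.length_le
  rw [List.length_append] at e1
  omega

/-! ### The word `Psi w` is a Dyck word -/

/-- The left half of `Psi w`. -/
def psiLeft (w : List ℕ) : List DyckStep :=
  (List.range' 1 w.length).map fun i => if i ∈ insRow w then U else DyckStep.D

/-- The right half of `Psi w`. -/
def psiRight (w : List ℕ) : List DyckStep :=
  (List.range' 1 w.length).reverse.map fun j => if j ∈ recRow w then DyckStep.D else U

theorem Psi_eq (w : List ℕ) : Psi w = psiLeft w ++ psiRight w := rfl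

theorem countP_mem_range' {r : List ℕ} (hr : r.Nodup) (p : ℕ) (h : ∀ x ∈ r, 1 ≤ x) :
    (List.range' 1 p).countP (fun i => decide (i ∈ r)) = r.countP fun i => decide (i ≤ p) := by
  rw [List.countP_eq_length_filter, List.countP_eq_length_filter]
  refine List.Perm.length_eq ((List.perm_ext_iff_of_nodup (List.Nodup.filter _ List.nodup_range')
    (hr.filter _)).2 fun x => ?_)
  simp only [List.mem_filter, List.mem_range'_1, decide_eq_true_eq]
  constructor
  · rintro ⟨h1, h2⟩
    exact ⟨h2, by omega⟩
  · rintro ⟨h1, h2⟩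
    exact ⟨by have := h x h1; omega, h1⟩

theorem count_add_count (D : List DyckStep) : D.count U + D.count DyckStep.D = D.length := by
  induction D with
  | nil => rfl
  | cons x D ih => cases x <;> simp <;> omega

theorem count_up_map (l r : List ℕ) :
    (l.map fun i => if i ∈ r then U else DyckStep.D).count U =
      l.countP fun i => decide (i ∈ r) := by
  rw [List.count, List.countP_map]
  refine List.countP_congr fun x _ => ?_
  by_cases h : x ∈ r <;> simp [h]

theorem count_down_map (l r : List ℕ) :
    (l.map fun i => if i ∈ r then DyckStep.D else U).count DyckStep.D =
      l.countP fun i => decide (i ∈ r) := by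
  rw [List.count, List.countP_map]
  refine List.countP_congr fun x _ => ?_
  by_cases h : x ∈ r <;> simp [h]

theorem length_psiLeft (w : List ℕ) : (psiLeft w).length = w.length := by simp [psiLeft]

theorem length_psiRight (w : List ℕ) : (psiRight w).length = w.length := by simp [psiRight]

section Psi

variable {n : ℕ} {w : List ℕ}

theorem IsPermOf.insRow_nodup (hp : IsPermOf n w) : (insRow w).Nodup := by
  obtain ⟨l, hl, hs⟩ := insRow_subset w
  exact hl.nodup_iff.1 (hp.nodup.sublist hs)

theorem IsPermOf.mem_insRow (hp : IsPermOf n w) {x : ℕ} (h : x ∈ insRow w) : 1 ≤ x ∧ x ≤ n :=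
  hp.mem_iff.1 ((insRow_subset w).subset h)

theorem recRow_nodup (w : List ℕ) : (recRow w).Nodup :=
  (List.nodup_range' (step := 1)).sublist (recRow_sublist w)

theorem mem_recRow {x : ℕ} (h : x ∈ recRow w) : 1 ≤ x ∧ x ≤ w.length := by
  have := (recRow_sublist w).subset h
  rw [List.mem_range'_1] at this
  omega

theorem IsPermOf.count_up_psiLeft_take (hp : IsPermOf n w) {p : ℕ} (h : p ≤ n) :
    ((psiLeft w).take p).count U = (insRow w).countP fun i => decide (i ≤ p) := by
  rw [psiLeft, hp.length_eq, ← List.map_take, List.take_range'_of_length_ge h, count_up_map]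
  exact countP_mem_range' hp.insRow_nodup p fun x hx => (hp.mem_insRow hx).1

/-- The steps after the first p of the right half record the positions up to |w| - p, hence the
recording tableau of a prefix, whose first row is as long as that of the insertion tableau. -/
theorem count_down_psiRight_drop (w : List ℕ) (p : ℕ) :
    ((psiRight w).drop p).count DyckStep.D = (insRow (w.take (w.length - p))).length := by
  rw [psiRight, ← List.map_drop, List.drop_reverse, List.length_range',
    List.take_range'_of_length_ge (by omega), count_down_map, List.countP_reverse,
    countP_mem_range' (recRow_nodup w) _ fun x hx => (mem_recRow hx).1,
    length_insRow, recRow_take w (by omega), List.countP_eq_length_filter]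

theorem IsPermOf.count_up_psiLeft (hp : IsPermOf n w) :
    (psiLeft w).count U = (insRow w).length := by
  have h := hp.count_up_psiLeft_take le_rfl
  rw [List.take_of_length_le (by rw [length_psiLeft, hp.length_eq])] at h
  rw [h, List.countP_eq_length]
  exact fun x hx => by simpa using (hp.mem_insRow hx).2

theorem count_down_psiRight (w : List ℕ) :
    (psiRight w).count DyckStep.D = (insRow w).length := by
  simpa using count_down_psiRight_drop w 0

/-- The first rows of the two tableaux have the same length. This is the balance that
`PhiInv_insert` requires of a cut. -/
theorem IsPermOf.count_down_psiLeft (hp : IsPermOf n w) :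
    (psiLeft w).count DyckStep.D = (psiRight w).count U := by
  have h1 := count_add_count (psiLeft w)
  have h2 := count_add_count (psiRight w)
  rw [length_psiLeft] at h1
  rw [length_psiRight] at h2
  have := hp.count_up_psiLeft
  have := count_down_psiRight w
  omega

theorem IsPermOf.count_up_Psi (hp : IsPermOf n w) : (Psi w).count U = n := by
  have h1 := count_add_count (psiLeft w)
  rw [length_psiLeft, hp.length_eq] at h1
  rw [Psi_eq, List.count_append, ← hp.count_down_psiLeft, h1]

theorem countP_le_range' {p n : ℕ} (h : p ≤ n) :
    (List.range' 1 n).countP (fun i => decide (i ≤ p)) = p := by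
  have := countP_mem_range' (List.nodup_range' (s := 1) (n := n) (step := 1)) p
    fun x hx => by rw [List.mem_range'_1] at hx; omega
  rw [← this, List.countP_eq_length.2, List.length_range']
  intro x hx
  simp only [List.mem_range'_1, decide_eq_true_eq] at hx ⊢
  omega

/-- In the left half, at least half of the letters up to p are in the first row. The right half is
read from its end: there, the first row of a prefix of w contains at least half of its letters. -/
theorem IsPermOf.isDyck_Psi (hp : IsPermOf n w) (ha : Avoids [3, 2, 1] w) : IsDyck (Psi w) := by
  have hl := hp.length_eq
  have h0 : height (Psi w) (Psi w).length = 0 := by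
    rw [height, List.take_length, Psi_eq, List.count_append, List.count_append,
      hp.count_up_psiLeft, count_down_psiRight, hp.count_down_psiLeft]
    push_cast
    ring
  refine ⟨fun p => ?_, h0⟩
  by_cases h : p ≤ n
  · rw [Psi_eq, height_append_left _ _ (by rw [length_psiLeft]; omega), height]
    have h1 := count_add_count ((psiLeft w).take p)
    rw [List.length_take, length_psiLeft, hl, min_eq_left h] at h1
    have h2 := hp.count_up_psiLeft_take h
    have h3 := countP_le_two_mul_countP_insRow ha p
    rw [List.Perm.countP_eq _ hp, countP_le_range' h] at h3
    omega
  -- Since the path ends at height 0, its height at p is the excess of down-steps over up-steps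
  -- after p.
  · have e : (Psi w).drop p = (psiRight w).drop (p - n) := by
      rw [Psi_eq, List.drop_append, List.drop_of_length_le (by rw [length_psiLeft]; omega),
        length_psiLeft, hl]
      rfl
    have h1 := count_down_psiRight_drop w (p - n)
    have h2 := count_add_count ((psiRight w).drop (p - n))
    rw [List.length_drop, length_psiRight, hl] at h2
    have h3 := length_le_two_mul_length_insRow (ha.of_sublist (List.take_sublist (n - (p - n)) w))
    rw [List.length_take, hl, min_eq_left (by omega)] at h3
    rw [hl] at h1
    have hu : (Psi w).count U = ((Psi w).take p).count U + ((Psi w).drop p).count U := by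
      rw [← List.count_append, List.take_append_drop]
    have hd : (Psi w).count DyckStep.D =
        ((Psi w).take p).count DyckStep.D + ((Psi w).drop p).count DyckStep.D := by
      rw [← List.count_append, List.take_append_drop]
    rw [height, List.take_length] at h0
    rw [height]
    rw [e] at hu hd
    omega

end Psi

/-! ### The map `Theta` and direct sums -/

theorem Theta_eq (w : List ℕ) : Theta w = PhiInv (Psi w) := rfl

theorem Theta_mem_avoidersOf {n : ℕ} {σ : List ℕ} (h : σ ∈ avoidersOf [3, 2, 1] n) :
    Theta σ ∈ avoidersOf [1, 3, 2] n := by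
  obtain ⟨hp, ha⟩ := h
  have := (hp.isDyck_Psi ha).PhiInv_mem_avoidersOf
  rwa [hp.count_up_Psi] at this

theorem shift_append (a b : List ℕ) (m : ℕ) : shift (a ++ b) m = shift a m ++ shift b m :=
  List.map_append

theorem directSum_append_singleton (a b : List ℕ) (x : ℕ) :
    directSum a (b ++ [x]) = directSum a b ++ [x + a.length] := by
  rw [directSum, directSum, shift_append, ← List.append_assoc]
  rfl

theorem length_directSum (a b : List ℕ) : (directSum a b).length = a.length + b.length := by
  simp [directSum, shift]

/-- The shifted letters exceed all those of a, so they are inserted past `insRow a` as if it were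
absent. -/
theorem insRow_directSum {n : ℕ} {a : List ℕ} (ha : IsPermOf n a) (b : List ℕ) :
    insRow (directSum a b) = insRow a ++ shift (insRow b) n := by
  induction b using List.reverseRecOn with
  | nil =>
    have e : directSum a [] = a := List.append_nil a
    rw [e]
    exact (List.append_nil _).symm
  | append_singleton b x ih =>
    rw [directSum_append_singleton, insRow_append_singleton, ih, insRow_append_singleton,
      ha.length_eq, rowInsert_append _ fun y hy => by have := ha.mem_insRow hy; omega,
      rowInsert_shift]

theorem recRow_directSum {n : ℕ} {a : List ℕ} (ha : IsPermOf n a) (b : List ℕ) :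
    recRow (directSum a b) = recRow a ++ shift (recRow b) n := by
  induction b using List.reverseRecOn with
  | nil =>
    have e : directSum a [] = a := List.append_nil a
    rw [e]
    exact (List.append_nil _).symm
  | append_singleton b x ih =>
    rw [directSum_append_singleton, recRow_append_singleton, ih, recRow_append_singleton,
      insRow_directSum ha, ha.length_eq,
      rowInsert_append _ fun y hy => by have := ha.mem_insRow hy; omega, rowInsert_shift,
      length_directSum, ha.length_eq]
    cases (rowInsert x (insRow b)).2 with
    | none =>
      simp [shift]
      omega
    | some y => simp

theorem range'_one_add (m n : ℕ) :
    List.range' 1 (m + n) = List.range' 1 m ++ (List.range' 1 n).map (· + m) := by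
  have h := List.map_add_range' (a := m) 1 n 1
  rw [← List.range'_append_1, Nat.add_comm 1 m, ← h]
  simp only [Nat.add_comm]

theorem mem_append_shift_of_le {r s : List ℕ} {m i : ℕ} (hs : ∀ x ∈ s, 1 ≤ x) (hi : i ≤ m) :
    i ∈ r ++ shift s m ↔ i ∈ r := by
  rw [List.mem_append, or_iff_left]
  intro h
  obtain ⟨x, hx, rfl⟩ := List.mem_map.1 h
  have := hs x hx
  omega

theorem add_mem_append_shift {r s : List ℕ} {m i : ℕ} (hr : ∀ x ∈ r, x ≤ m) (hi : 1 ≤ i) :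
    i + m ∈ r ++ shift s m ↔ i ∈ s := by
  rw [List.mem_append, or_iff_right fun h => by have := hr _ h; omega, shift, List.mem_map]
  simp

theorem map_range'_append_shift {γ : Type*} {r s : List ℕ} {m n : ℕ} (hr : ∀ x ∈ r, x ≤ m)
    (hs : ∀ x ∈ s, 1 ≤ x) (x y : γ) :
    (List.range' 1 (m + n)).map (fun i => if i ∈ r ++ shift s m then x else y) =
      (List.range' 1 m).map (fun i => if i ∈ r then x else y) ++
        (List.range' 1 n).map fun i => if i ∈ s then x else y := by
  rw [range'_one_add, List.map_append, List.map_map]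
  congr 1
  · refine List.map_congr_left fun i hi => ?_
    rw [List.mem_range'_1] at hi
    simp only [mem_append_shift_of_le (r := r) hs (show i ≤ m by omega)]
  · refine List.map_congr_left fun i hi => ?_
    rw [List.mem_range'_1] at hi
    simp only [Function.comp, add_mem_append_shift (s := s) hr hi.1]

/-- Both first rows of the sum are concatenations. The right half is read backwards, so the half of
b precedes that of a and the two halves of b meet at the center. -/
theorem Psi_directSum {m n : ℕ} {a b : List ℕ} (ha : IsPermOf m a) (hb : IsPermOf n b) :
    Psi (directSum a b) = psiLeft a ++ (Psi b ++ psiRight a) := by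
  have h1 : psiLeft (directSum a b) = psiLeft a ++ psiLeft b := by
    rw [psiLeft, insRow_directSum ha, length_directSum, psiLeft, psiLeft, ha.length_eq]
    exact map_range'_append_shift (fun x hx => (ha.mem_insRow hx).2)
      (fun x hx => (hb.mem_insRow hx).1) _ _
  have h2 : psiRight (directSum a b) = psiRight b ++ psiRight a := by
    rw [psiRight, recRow_directSum ha, length_directSum, psiRight, psiRight, List.map_reverse,
      List.map_reverse, List.map_reverse, ha.length_eq, map_range'_append_shift
        (fun x hx => (mem_recRow hx).2.trans ha.length_eq.le) (fun x hx => (mem_recRow hx).1),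
      List.reverse_append]
  rw [Psi_eq, h1, h2, Psi_eq]
  simp only [List.append_assoc]

theorem isPermOf_directSum {m n : ℕ} {a b : List ℕ} (ha : IsPermOf m a) (hb : IsPermOf n b) :
    IsPermOf (m + n) (directSum a b) := by
  rw [IsPermOf, range'_one_add, directSum, ha.length_eq]
  exact List.Perm.append ha (List.Perm.map _ hb)

theorem avoids_321_directSum {m : ℕ} {a b : List ℕ} (ha : IsPermOf m a)
    (aa : Avoids [3, 2, 1] a) (ab : Avoids [3, 2, 1] b) : Avoids [3, 2, 1] (directSum a b) := by
  rw [avoids_321_iff] at *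
  intro x y z hs hzy hyx
  rw [directSum] at hs
  -- Nothing prevents b from having a letter 0 here, so equality with m has to be allowed; it is
  -- harmless, as the pattern decreases strictly.
  have big : ∀ v ∈ shift b a.length, m < v ∨ v = m := fun v hv => by
    obtain ⟨u, hu, rfl⟩ := List.mem_map.1 hv
    have := ha.length_eq
    omega
  have low : ∀ v ∈ a, v ≤ m := fun v hv => (ha.mem_iff.1 hv).2
  -- A decreasing triple cannot pass from a to the larger letters of the shifted b, so it lies
  -- within one summand.
  obtain ⟨l, r, e, hl, hr⟩ := List.sublist_append_iff.1 hs
  match l, e with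
  | [], e =>
    rw [List.nil_append] at e
    subst e
    obtain ⟨s, hs, e⟩ := List.sublist_map_iff.1 hr
    obtain ⟨p, q, t, rfl⟩ : ∃ p q t, s = [p, q, t] := List.length_eq_three.1 (by
      simpa using (congrArg List.length e).symm)
    simp only [List.map_cons, List.map_nil, List.cons.injEq, and_true] at e
    exact ab p q t hs (by omega) (by omega)
  | [p], e =>
    simp only [List.cons_append, List.nil_append, List.cons.injEq] at e
    obtain ⟨rfl, rfl⟩ := e
    have h1 := low x (hl.subset (by simp))
    have h2 := big y (hr.subset (by simp))
    omega
  | [p, q], e =>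
    simp only [List.cons_append, List.nil_append, List.cons.injEq] at e
    obtain ⟨rfl, rfl, rfl⟩ := e
    have h1 := low y (hl.subset (by simp))
    have h2 := big z (hr.subset (by simp))
    omega
  | p :: q :: t :: l, e =>
    simp only [List.cons_append, List.cons.injEq] at e
    obtain ⟨rfl, rfl, rfl, e⟩ := e
    obtain ⟨rfl, rfl⟩ := List.append_eq_nil_iff.1 e.symm
    exact aa x y z hl hzy hyx

theorem directSum_mem_avoiders {a b : List ℕ} (ha : a ∈ avoiders [3, 2, 1])
    (hb : b ∈ avoiders [3, 2, 1]) : directSum a b ∈ avoiders [3, 2, 1] := by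
  rw [mem_avoiders_iff] at *
  exact ⟨by rw [length_directSum]; exact isPermOf_directSum ha.1 hb.1,
    avoids_321_directSum ha.1 ha.2 hb.2⟩

theorem Theta_directSum {a b : List ℕ} (ha : a ∈ avoiders [3, 2, 1])
    (hb : b ∈ avoiders [3, 2, 1]) :
    Theta (directSum a b) = directProd (Theta b) (Theta a) := by
  rw [mem_avoiders_iff] at *
  rw [Theta_eq, Theta_eq, Theta_eq, Psi_directSum ha.1 hb.1, Psi_eq a]
  exact PhiInv_insert (Psi_eq a ▸ ha.1.isDyck_Psi ha.2) (hb.1.isDyck_Psi hb.2)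
    ha.1.count_down_psiLeft

end PermWord

theorem mainTheorem11 :
    -- `Θ` maps `S_n(321)` to `S_n(132)`
    (∀ n : ℕ, ∀ σ ∈ PermWord.avoidersOf [3, 2, 1] n,
      PermWord.Theta σ ∈ PermWord.avoidersOf [1, 3, 2] n) ∧
    -- `S(321)` is closed under `⊕`, and `Θ(σ₁ ⊕ σ₂) = Θ(σ₂) ⊗ Θ(σ₁)`
    (∀ σ₁ ∈ PermWord.avoiders [3, 2, 1], ∀ σ₂ ∈ PermWord.avoiders [3, 2, 1],
      PermWord.directSum σ₁ σ₂ ∈ PermWord.avoiders [3, 2, 1] ∧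
      PermWord.Theta (PermWord.directSum σ₁ σ₂) =
        PermWord.directProd (PermWord.Theta σ₂) (PermWord.Theta σ₁)) ∧
    -- `S(132)` is closed under `⊗`
    (∀ α ∈ PermWord.avoiders [1, 3, 2], ∀ β ∈ PermWord.avoiders [1, 3, 2],
      PermWord.directProd α β ∈ PermWord.avoiders [1, 3, 2]) ∧
    -- `⊗` is associative on `S(132)`
    (∀ α ∈ PermWord.avoiders [1, 3, 2], ∀ β ∈ PermWord.avoiders [1, 3, 2],
      ∀ γ ∈ PermWord.avoiders [1, 3, 2],
      PermWord.directProd (PermWord.directProd α β) γ =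
        PermWord.directProd α (PermWord.directProd β γ)) ∧
    -- crossings are additive under `⊗`
    (∀ α ∈ PermWord.avoiders [1, 3, 2], ∀ β ∈ PermWord.avoiders [1, 3, 2],
      PermWord.crs (PermWord.directProd α β) = PermWord.crs α + PermWord.crs β) := by
  refine ⟨fun n σ h => PermWord.Theta_mem_avoidersOf h, fun σ₁ h₁ σ₂ h₂ =>
    ⟨PermWord.directSum_mem_avoiders h₁ h₂, PermWord.Theta_directSum h₁ h₂⟩,
    fun α hα β hβ => PermWord.directProd_mem_avoiders hα hβ, fun α hα β hβ γ hγ => ?_,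
    fun α hα β hβ => ?_⟩
  · rw [PermWord.mem_avoiders_iff] at hβ hγ
    exact PermWord.directProd_assoc hβ.1 hγ.1 hβ.2 hγ.2
  · rw [PermWord.mem_avoiders_iff] at hα hβ
    exact PermWord.crs_directProd hα.1 hβ.1 hβ.2
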